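/- Let $M$ be a ($C^\infty$, Hausdorff) $n$-dimensional manifold, $w$ a Poisson structure on $M$ (a smooth bivector field whose bracket $\{f,g\}_w=w(df,dg)$ satisfies the Jacobi identity), and $\nabla$ a smooth linear connection on $M$. Let $\pi:T^*M\to M$ be the cotangent bundle, with coordinates $(x^i,p_i)$ induced by local coordinates $(x^i)$ of $M$. Let $\lambda$ be the Liouville form, $\lambda_\alpha(\xi)=\alpha(d\pi\,\xi)$, let $\omega=d\lambda=dp_i\wedge dx^i$ be the canonical symplectic form, and let $W_0$ be the canonical bivector field, $W_0(\Phi,\Psi)=\omega(\sharp_\omega\Phi,\sharp_\omega\Psi)$, where $\sharp_\omega$ is the inverse of $X\mapsto i_X\omega$. Define $\sharp_w:T^*M\to TM$ by $\beta(\sharp_w\alpha)=w(\alpha,\beta)$, and let $K$ be the vector field on $T^*M$ given by $$K(\alpha)=(\sharp_w\alpha)^H_\alpha,\qquad \alpha\in T^*M,$$ where the horizontal lift $X^H_\alpha\in T_\alpha T^*M$ of $X\in T_{\pi(\alpha)}M$ with respect to $\nabla$ is the unique vector with $d\pi(X^H_\alpha)=X$ and $X^H_\alpha(m(Y))=\alpha(\nabla_XY)$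 for all vector fields $Y$ of $M$; here $m(Y)(\alpha)=\alpha(Y)$. Let $$W_2=\tfrac12\,\mathcal L_KW_0 .$$ Then $W_2$ is a smooth bivector field on $T^*M$ such that: 1. $W_2$ is graded: in the coordinates $(x^i,p_i)$ induced by any chart of $M$, $$W_2=\tfrac12 w^{ij}(x)\,\frac{\partial}{\partial x^i}\wedge\frac{\partial}{\partial x^j}+p_aA^{ia}_j(x)\,\frac{\partial}{\partial x^i}\wedge\frac{\partial}{\partial p_j}+\tfrac12\,p_ap_bC^{ab}_{ij}(x)\,\frac{\partial}{\partial p_i}\wedge\frac{\partial}{\partial p_j}$$ with smooth functions $w^{ij},A^{ia}_j,C^{ab}_{ij}$ on the domain of the chart; 2. $W_2$ is a semi-Poisson structure, that is, a transversal Poisson structure of the foliation of $T^*M$ by the fibres of $\pi$: the bracket $\{F,G\}_{W_2}=W_2(dF,dG)$ is a Lie algebra bracket on the space of smooth functions on $T^*M$ that are constant on the fibres of $\pi$ (in particular this space is closed under it); 3. $W_2$ is $\pi$-related with $w$: $W_2(\pi^*\varphi,\pi^*\psi)_\alpha=w(\varphi,\psi)_{\pi(\alpha)}$ for all $\alpha\in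 T^*M$ and all $\varphi,\psi\in T^*_{\pi(\alpha)}M$. -/

import Mathlib

open Bundle
open scoped Manifold ContDiff

noncomputable section

namespace PoissonLift

section Manifold

variable {E : Type*} [NormedAddCommGroup E] [NormedSpace ℝ E]
  {H : Type*} [TopologicalSpace H] (I : ModelWithCorners ℝ E H)
  {N : Type*} [TopologicalSpace N] [ChartedSpace H N]

/-- The cotangent space of `N` at `z`. -/
abbrev Covector (z : N) : Type _ := TangentSpace I z →L[ℝ] ℝ

/-- Families of real functions of two covectors, one for each point of `N`; the bivector fields are
those that satisfy `IsBivectorField`. A bivector is evaluated on covectors by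
`(u ∧ v)(Φ, Ψ) = Φ(u) Ψ(v) - Φ(v) Ψ(u)`. -/
abbrev BiField (N : Type*) [TopologicalSpace N] [ChartedSpace H N] : Type _ :=
  ∀ z : N, Covector I z → Covector I z → ℝ

/-- Smooth real functions. -/
def IsSmooth (f : N → ℝ) : Prop := ContMDiff I 𝓘(ℝ, ℝ) ∞ f

/-- The bracket `{f, g}_W = W(df, dg)`. -/
def bracket (W : BiField I N) (f g : N → ℝ) : N → ℝ :=
  fun z => W z (mvfderiv I f z) (mvfderiv I g z)

/-- `W` is a (smooth) bivector field: pointwise an alternating bilinear form on covectors, such that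
`W(df, dg)` is smooth for all smooth functions `f` and `g`. -/
structure IsBivectorField (W : BiField I N) : Prop where
  add_left : ∀ (z : N) (Φ Φ' Ψ : Covector I z), W z (Φ + Φ') Ψ = W z Φ Ψ + W z Φ' Ψ
  smul_left : ∀ (z : N) (c : ℝ) (Φ Ψ : Covector I z), W z (c • Φ) Ψ = c * W z Φ Ψ
  skew : ∀ (z : N) (Φ Ψ : Covector I z), W z Φ Ψ = -W z Ψ Φ
  smooth : ∀ f g : N → ℝ, IsSmooth I f → IsSmooth I g → IsSmooth I (bracket I W f g)

/-- `W` is a Poisson structure: a bivector field whose bracket satisfies the Jacobi identity. -/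
structure IsPoisson (W : BiField I N) : Prop where
  isBivectorField : IsBivectorField I W
  jacobi : ∀ f g h : N → ℝ, IsSmooth I f → IsSmooth I g → IsSmooth I h → ∀ z : N,
    bracket I W f (bracket I W g h) z + bracket I W g (bracket I W h f) z +
      bracket I W h (bracket I W f g) z = 0

/-- The tangent vector `Φ^♯` with `Ψ(Φ^♯) = W(Φ, Ψ)` for all covectors `Ψ`. -/
def sharp (W : BiField I N) (z : N) (Φ : Covector I z) : TangentSpace I z :=
  Classical.epsilon fun v => ∀ Ψ : Covector I z, Ψ v = W z Φ Ψ

/-- The exterior derivative of a `1`-form, by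
`dθ(u, v) = u(θ(V)) - v(θ(U)) - θ([U, V])`, where `U` and `V` are vector fields, smooth near `z`,
that extend the tangent vectors `u` and `v` at `z`. -/
def extDerivOneForm (θ : ∀ z : N, Covector I z) [IsManifold I 1 N]
    (z : N) (u v : TangentSpace I z) : ℝ :=
  mvfderiv I (fun y => θ y (FiberBundle.extend E v y)) z u
    - mvfderiv I (fun y => θ y (FiberBundle.extend E u y)) z v
    - θ z (VectorField.mlieBracket I (FiberBundle.extend E u) (FiberBundle.extend E v) z)

/-- The inverse `♯_Ω` of `X ↦ i_X Ω = Ω(X, ·)` for a nondegenerate `2`-form `Ω`. -/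
def sharpForm (Ω : ∀ z : N, TangentSpace I z → TangentSpace I z → ℝ) (z : N)
    (Φ : Covector I z) : TangentSpace I z :=
  Classical.epsilon fun X => ∀ Y : TangentSpace I z, Ω z X Y = Φ Y

/-- A function near `z` with differential `Φ` at `z`, namely the function that is given by the
linear form `Φ` in the preferred chart at `z`. -/
def extendCovector (z : N) (Φ : Covector I z) : N → ℝ :=
  fun y => (Φ : E →L[ℝ] ℝ) (extChartAt I z y)

/-- The Lie derivative `L_K W` of a bivector field along a vector field. It is determined by
`(L_K W)(dF, dG) = K(W(dF, dG)) - W(d(K F), dG) - W(dF, d(K G))`; here, for covectors `Φ` and `Ψ`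
at `z`, functions `F` and `G` with these differentials at `z` are inserted. -/
def lieDerivative (K : ∀ z : N, TangentSpace I z) (W : BiField I N) : BiField I N :=
  fun z Φ Ψ =>
    mvfderiv I (bracket I W (extendCovector I z Φ) (extendCovector I z Ψ)) z (K z)
      - W z (mvfderiv I (fun y => mvfderiv I (extendCovector I z Φ) y (K y)) z) Ψ
      - W z Φ (mvfderiv I (fun y => mvfderiv I (extendCovector I z Ψ) y (K y)) z)

end Manifold

section Cotangent

variable {n : ℕ} {M : Type*} [TopologicalSpace M] [ChartedSpace (EuclideanSpace ℝ (Fin n)) M]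

/-- The model fibre of the cotangent bundle. -/
abbrev CotangentModel (n : ℕ) : Type := EuclideanSpace ℝ (Fin n) →L[ℝ] ℝ

/-- The model with corners of the cotangent bundle. -/
abbrev cotangentI (n : ℕ) := (𝓡 n).prod 𝓘(ℝ, CotangentModel n)

variable [IsManifold (𝓡 n) ∞ M]

variable (n M) in
/-- The cotangent bundle `T*M`; its points are pairs `⟨x, α⟩` with `α` a covector at `x`. -/
abbrev CotangentBundle : Type _ :=
  TotalSpace (CotangentModel n) (fun x : M => TangentSpace (𝓡 n) x →L[ℝ] ℝ)

variable (n M) in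
/-- The projection `π : T*M → M`. -/
def proj : CotangentBundle n M → M := TotalSpace.proj

/-- The differential of `π` at `α`. -/
def dproj (α : CotangentBundle n M) :
    TangentSpace (cotangentI n) α →L[ℝ] TangentSpace (𝓡 n) α.proj :=
  mfderiv (cotangentI n) (𝓡 n) (proj n M) α

variable (n M) in
/-- The Liouville form: `λ_α(ξ) = α(dπ ξ)`. -/
def liouville (α : CotangentBundle n M) : Covector (cotangentI n) α := α.snd.comp (dproj α)

variable (n M) in
/-- The canonical symplectic form `ω = dλ`. -/
def canonicalForm (α : CotangentBundle n M) (ξ η : TangentSpace (cotangentI n) α) : ℝ :=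
  extDerivOneForm (cotangentI n) (liouville n M) α ξ η

variable (n M) in
/-- The canonical bivector field of `T*M`: `W₀(Φ, Ψ) = ω(♯_ω Φ, ♯_ω Ψ)`. -/
def canonicalBivector : BiField (cotangentI n) (CotangentBundle n M) :=
  fun α Φ Ψ => canonicalForm n M α (sharpForm (cotangentI n) (canonicalForm n M) α Φ)
    (sharpForm (cotangentI n) (canonicalForm n M) α Ψ)

/-- The momentum `m(Y) : α ↦ α(Y)` of a vector field. -/
def momentum (Y : ∀ x : M, TangentSpace (𝓡 n) x) : CotangentBundle n M → ℝ :=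
  fun α => α.snd (Y α.proj)

/-- `ξ` is the horizontal lift of `X` to the point `α` of `T*M`, with respect to the connection on
`T*M` dual to `∇`: it projects to `X`, and `ξ(m(Y)) = α(∇_X Y)` for all vector fields `Y` that are
smooth near the base point. In coordinates, with `∇_{∂_k} ∂_i = Γ^b_{ki} ∂_b`, this is
`ξ = X^k (∂/∂x^k + p_b Γ^b_{ki} ∂/∂p_i)`. -/
def IsHorizontalLift
    (cov : CovariantDerivative (𝓡 n) (EuclideanSpace ℝ (Fin n))
      (TangentSpace (𝓡 n) : M → Type _))
    (α : CotangentBundle n M) (X : TangentSpace (𝓡 n) α.proj)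
    (ξ : TangentSpace (cotangentI n) α) : Prop :=
  dproj α ξ = X ∧
    ∀ Y : (∀ x : M, TangentSpace (𝓡 n) x),
      ContMDiffAt (𝓡 n) (𝓡 n).tangent ∞ (fun x => (⟨x, Y x⟩ : TangentBundle (𝓡 n) M)) α.proj →
      mvfderiv (cotangentI n) (momentum Y) α ξ = α.snd (cov Y α.proj X)

/-- The horizontal lift of a tangent vector to a point of `T*M`. -/
def horizontalLift
    (cov : CovariantDerivative (𝓡 n) (EuclideanSpace ℝ (Fin n))
      (TangentSpace (𝓡 n) : M → Type _))
    (α : CotangentBundle n M) (X : TangentSpace (𝓡 n) α.proj) : TangentSpace (cotangentI n) α :=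
  Classical.epsilon (IsHorizontalLift cov α X)

/-- The vector field `K(α) = (♯_w α)^H` on `T*M`. -/
def fieldK
    (cov : CovariantDerivative (𝓡 n) (EuclideanSpace ℝ (Fin n))
      (TangentSpace (𝓡 n) : M → Type _))
    (w : BiField (𝓡 n) M) (α : CotangentBundle n M) : TangentSpace (cotangentI n) α :=
  horizontalLift cov α (sharp (𝓡 n) w α.proj α.snd)

/-- The graded `∇`-lift `W₂ = ½ L_K W₀` of `w`. -/
def gradedLift
    (cov : CovariantDerivative (𝓡 n) (EuclideanSpace ℝ (Fin n))
      (TangentSpace (𝓡 n) : M → Type _))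
    (w : BiField (𝓡 n) M) : BiField (cotangentI n) (CotangentBundle n M) :=
  fun α Φ Ψ =>
    (1 / 2 : ℝ) * lieDerivative (cotangentI n) (fieldK cov w) (canonicalBivector n M) α Φ Ψ

/-- The base coordinate function `x^i` on `T*M` that comes from a chart `e` of `M`. -/
def coordX (e : OpenPartialHomeomorph M (EuclideanSpace ℝ (Fin n))) (i : Fin n) :
    CotangentBundle n M → ℝ :=
  fun α => e α.proj i

/-- The covector coordinate function `p_i : α ↦ α(∂/∂x^i)` on `T*M` that comes from a chart `e` of
`M`. -/
def coordP (e : OpenPartialHomeomorph M (EuclideanSpace ℝ (Fin n))) (i : Fin n) :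
    CotangentBundle n M → ℝ :=
  momentum fun x => (mvfderiv (𝓡 n) e x).inverse (EuclideanSpace.single i (1 : ℝ))

/-- `W` is a graded bivector field on `T*M`: in the coordinates `(x^i, p_i)` that come from any
smooth chart of `M`, it has the form
`W = ½ w^{ij}(x) ∂/∂x^i ∧ ∂/∂x^j + p_a A^{ia}_j(x) ∂/∂x^i ∧ ∂/∂p_j
  + ½ p_a p_b C^{ab}_{ij}(x) ∂/∂p_i ∧ ∂/∂p_j`
with smooth functions `w^{ij}`, `A^{ia}_j`, `C^{ab}_{ij}` on the domain of the chart. -/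
structure IsGraded (W : BiField (cotangentI n) (CotangentBundle n M)) : Prop where
  isBivectorField : IsBivectorField (cotangentI n) W
  local_form : ∀ e ∈ IsManifold.maximalAtlas (𝓡 n) ∞ M,
    ∃ (c : Fin n → Fin n → M → ℝ) (A : Fin n → Fin n → Fin n → M → ℝ)
      (C : Fin n → Fin n → Fin n → Fin n → M → ℝ),
      (∀ i j, ContMDiffOn (𝓡 n) 𝓘(ℝ, ℝ) ∞ (c i j) e.source) ∧
      (∀ i a j, ContMDiffOn (𝓡 n) 𝓘(ℝ, ℝ) ∞ (A i a j) e.source) ∧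
      (∀ a b i j, ContMDiffOn (𝓡 n) 𝓘(ℝ, ℝ) ∞ (C a b i j) e.source) ∧
      ∀ α : CotangentBundle n M, α.proj ∈ e.source → ∀ i j : Fin n,
        bracket (cotangentI n) W (coordX e i) (coordX e j) α = c i j α.proj ∧
        bracket (cotangentI n) W (coordX e i) (coordP e j) α =
          ∑ a, coordP e a α * A i a j α.proj ∧
        bracket (cotangentI n) W (coordP e i) (coordP e j) α =
          ∑ a, ∑ b, coordP e a α * coordP e b α * C a b i j α.proj

/-- The foliated functions of the vertical foliation of `T*M`: smooth functions that are constant on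
the fibres of `π`. -/
structure IsFoliated (F : CotangentBundle n M → ℝ) : Prop where
  smooth : IsSmooth (cotangentI n) F
  const_on_fibres : ∀ α β : CotangentBundle n M, α.proj = β.proj → F α = F β

/-- `W` is a semi-Poisson structure on `T*M`, that is, a transversal Poisson structure of the
vertical foliation: a bivector field such that `W(dF, dG)` is a Lie algebra bracket on the space of
foliated functions. (Bilinearity and skew-symmetry of the bracket hold for any bivector field.) -/
structure IsSemiPoisson (W : BiField (cotangentI n) (CotangentBundle n M)) : Prop where
  isBivectorField : IsBivectorField (cotangentI n) W
  closed : ∀ F G : CotangentBundle n M → ℝ, IsFoliated F → IsFoliated G →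
    IsFoliated (bracket (cotangentI n) W F G)
  jacobi : ∀ F G L : CotangentBundle n M → ℝ, IsFoliated F → IsFoliated G → IsFoliated L →
    ∀ α : CotangentBundle n M,
      bracket (cotangentI n) W F (bracket (cotangentI n) W G L) α +
        bracket (cotangentI n) W G (bracket (cotangentI n) W L F) α +
        bracket (cotangentI n) W L (bracket (cotangentI n) W F G) α = 0

/-- `W` on `T*M` is `π`-related to `w` on `M`: `W_α(π^*φ, π^*ψ) = w_{π(α)}(φ, ψ)` for all covectors
`φ` and `ψ` of `M` at `π(α)`. -/
def IsProjRelated (W : BiField (cotangentI n) (CotangentBundle n M)) (w : BiField (𝓡 n) M) : Prop :=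
  ∀ (α : CotangentBundle n M) (φ ψ : Covector (𝓡 n) α.proj),
    W α (φ.comp (dproj α)) (ψ.comp (dproj α)) = w α.proj φ ψ

end Cotangent

end PoissonLift

end

open PoissonLift

/-! Everything reduces to three brackets of the canonical bivector field. For functions f, g and
vector fields X, Y on M, {π^*f, π^*g} = 0, {m(Y), π^*f} = π^*(Y f), {m(X), m(Y)} = m([X, Y])
(`bracket_projection_projection`, `bracket_momentum_projection`, `bracket_momentum_momentum`). In
particular {p_i, p_j} = 0 and {p_i, x^j} = δ_i^j in every chart. The field K raises the degree in
the momenta by one: K(π^*f) = p_a {x^a, f}_w = -m(♯_w df), and K(m(Y)) = α(∇_{♯_w α} Y) = p_a p_b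
Q^{ab}(Y), where Q is `hamiltonianCov`.

These values are inserted into 2 {F, G}_{W₂} = K{F, G} - {K F, G} - {F, K G}. For pulled-back
functions the first term vanishes and the other two each give {f, g}_w
(`bracket_gradedLift_projection`). This is π-relatedness; since foliated functions are exactly the
pullbacks, it also transports closure and the Jacobi identity from w. For (x^i, p_j) and (p_i, p_j)
the first term differentiates a constant, and the other terms are linear, respectively quadratic, in
the momenta, which is gradedness.

Two points support the computation. `lieDerivative` inserts chart-linear functions, so its formula
for arbitrary functions needs tensoriality, which rests on the symmetry of the Hessian
(`lieExpr_eq_zero`, `lieDerivative_mvfderiv`). The form dλ is defined through extended tangent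
vectors; these have constant components in a chart, so their Lie brackets vanish and dλ takes its
Darboux form (`mlieBracket_extend`, `canonicalForm_apply`). The objects chosen by `epsilon` are
shown to have their defining properties in `apply_sharp`, `sharpForm_canonicalForm` and
`isHorizontalLift_horizontalLift`. -/

open PoissonLift

/-! ### Differentials of functions and second-order expansion in a chart. -/

section General
open Filter Topology
variable {E : Type*} [NormedAddCommGroup E] [NormedSpace ℝ E]
  {H : Type*} [TopologicalSpace H] {I : ModelWithCorners ℝ E H}
  {N : Type*} [TopologicalSpace N] [ChartedSpace H N]

theorem mvfderiv_congr {F : Type*} [NormedAddCommGroup F] [NormedSpace ℝ F] {f g : N → F} {z : N}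
    (h : f =ᶠ[𝓝 z] g) : mvfderiv I f z = mvfderiv I g z := by
  have h1 := h.mfderiv_eq (I := I) (I' := 𝓘(ℝ, F))
  ext v
  simp only [mvfderiv, ContinuousLinearMap.comp_apply]
  exact congrArg (fun L => (show TangentSpace I z →L[ℝ] F from L) v) h1

theorem mvfderiv_comp_fderiv {F G : Type*} [NormedAddCommGroup F] [NormedSpace ℝ F]
    [NormedAddCommGroup G] [NormedSpace ℝ G] {φ : N → F} {L : F → G} {z : N}
    (hφ : MDifferentiableAt I 𝓘(ℝ, F) φ z) (hL : DifferentiableAt ℝ L (φ z))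
    (v : TangentSpace I z) :
    mvfderiv I (fun y => L (φ y)) z v = fderiv ℝ L (φ z) (mvfderiv I φ z v) := by
  have h := hL.hasFDerivAt.hasMFDerivAt.comp z hφ.hasMFDerivAt
  have h1 := h.mfderiv
  exact congrArg (fun L => (show TangentSpace I z →L[ℝ] G from L) v) h1

theorem mvfderiv_sum_apply {ι : Type*} (s : Finset ι) {f : ι → N → ℝ} {z : N}
    (h : ∀ i ∈ s, MDifferentiableAt I 𝓘(ℝ, ℝ) (f i) z) :
    MDifferentiableAt I 𝓘(ℝ, ℝ) (fun y => ∑ i ∈ s, f i y) z ∧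
    mvfderiv I (fun y => ∑ i ∈ s, f i y) z = ∑ i ∈ s, mvfderiv I (f i) z := by
  classical
  induction s using Finset.induction_on with
  | empty => exact ⟨by simpa using mdifferentiableAt_const,
      by simpa using! mvfderiv_const (I := I) (0 : ℝ) (x := z)⟩
  | insert a s ha ih =>
    simp only [Finset.sum_insert ha]
    have := ih (fun i hi => h i (Finset.mem_insert_of_mem hi))
    have h2 := h a (Finset.mem_insert_self a s)
    refine ⟨h2.add this.1, ?_⟩
    rw [← this.2]
    exact mvfderiv_add h2 this.1

theorem mvfderiv_sum {ι : Type*} (s : Finset ι) {f : ι → N → ℝ} {z : N}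
    (h : ∀ i ∈ s, MDifferentiableAt I 𝓘(ℝ, ℝ) (f i) z) :
    mvfderiv I (fun y => ∑ i ∈ s, f i y) z = ∑ i ∈ s, mvfderiv I (f i) z :=
  (mvfderiv_sum_apply s h).2

theorem mvfderiv_sum_mul {ι : Type*} (s : Finset ι) {f g : ι → N → ℝ} {z : N}
    (hf : ∀ i ∈ s, MDifferentiableAt I 𝓘(ℝ, ℝ) (f i) z)
    (hg : ∀ i ∈ s, MDifferentiableAt I 𝓘(ℝ, ℝ) (g i) z) :
    mvfderiv I (fun y => ∑ i ∈ s, f i y * g i y) z =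
      ∑ i ∈ s, (f i z • mvfderiv I (g i) z + g i z • mvfderiv I (f i) z) := by
  refine (mvfderiv_sum s (f := fun i => f i * g i) (fun i hi => (hf i hi).mul (hg i hi))).trans ?_
  exact Finset.sum_congr rfl fun i hi => mvfderiv_mul (hf i hi) (hg i hi)

theorem ContMDiffAt.mdiff {F : Type*} [NormedAddCommGroup F] [NormedSpace ℝ F] {f : N → F} {z : N}
    (h : ContMDiffAt I 𝓘(ℝ, F) ∞ f z) : MDifferentiableAt I 𝓘(ℝ, F) f z :=
  h.mdifferentiableAt (by simp)

variable [IsManifold I ∞ N]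

theorem ContMDiffAt.eventually_mdiff {F : Type*} [NormedAddCommGroup F] [NormedSpace ℝ F]
    {f : N → F} {z : N}
    (h : ContMDiffAt I 𝓘(ℝ, F) ∞ f z) : ∀ᶠ y in 𝓝 z, MDifferentiableAt I 𝓘(ℝ, F) f y := by
  have : IsManifold I 1 N := .of_le (n := ∞) (by simp)
  have h1 : ContMDiffAt I 𝓘(ℝ, F) 1 f z := h.of_le (by simp)
  filter_upwards [(contMDiffAt_iff_contMDiffAt_nhds (by simp)).1 h1] with y hy
  exact hy.mdifferentiableAt (by simp)

theorem contMDiffAt_extendCovector (z : N) (ℓ : E →L[ℝ] ℝ) {y : N}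
    (hy : y ∈ (chartAt H z).source) :
    ContMDiffAt I 𝓘(ℝ, ℝ) ∞ (extendCovector I z ℓ) y := by
  have h1 : ContMDiffAt I 𝓘(ℝ, E) ∞ (extChartAt I z) y := contMDiffAt_extChartAt' hy
  exact (ℓ.contDiff.contMDiff.contMDiffAt).comp y h1

theorem mvfderiv_extendCovector (z : N) (ℓ : E →L[ℝ] ℝ) {y : N}
    (hy : y ∈ (chartAt H z).source) (v : TangentSpace I y) :
    mvfderiv I (extendCovector I z ℓ) y v = ℓ (mvfderiv I (extChartAt I z) y v) := by
  have : IsManifold I 1 N := .of_le (n := ∞) (by simp)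
  have h1 : MDifferentiableAt I 𝓘(ℝ, E) (extChartAt I z) y := mdifferentiableAt_extChartAt hy
  have := mvfderiv_comp_fderiv (L := ℓ) h1 ℓ.differentiableAt v
  rwa [ℓ.fderiv] at this

theorem mvfderiv_extChartAt_self (z : N) (v : TangentSpace I z) :
    mvfderiv I (extChartAt I z) z v = (show E from v) := by
  have : IsManifold I 1 N := .of_le (n := ∞) (by simp)
  have h1 := mfderiv_extChartAt_self (I := I) (x := z)
  exact congrArg (fun L => (show TangentSpace I z →L[ℝ] E from L) v) h1

theorem mvfderiv_extendCovector_self (z : N) (Φ : Covector I z)  :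
    mvfderiv I (extendCovector I z Φ) z = Φ := by
  ext v
  let ℓ : E →L[ℝ] ℝ := Φ
  have := mvfderiv_extendCovector z ℓ (mem_chart_source H z) v
  rw [mvfderiv_extChartAt_self] at this
  exact this

variable [FiniteDimensional ℝ E] [I.Boundaryless]

/-- The differential of a function near `z` in terms of coordinates of the chart at `z`. -/
theorem exists_coordinate_expansion {ι : Type*} [Fintype ι] (b : Module.Basis ι ℝ E) {z : N}
    {F : N → ℝ} (hF : ContMDiffAt I 𝓘(ℝ, ℝ) ∞ F z) :
    ∃ (D : ι → N → ℝ) (S : ι → ι → ℝ),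
      (∀ a, ContMDiffAt I 𝓘(ℝ, ℝ) ∞ (D a) z) ∧
      (∀ᶠ y in 𝓝 z, mvfderiv I F y =
        ∑ a, D a y • mvfderiv I (extendCovector I z (b.coord a).toContinuousLinearMap) y) ∧
      (∀ a, D a z = mvfderiv I F z (b a)) ∧ (∀ a c, S a c = S c a) ∧
      ∀ a, mvfderiv I (D a) z =
        ∑ c, S a c • mvfderiv I (extendCovector I z (b.coord c).toContinuousLinearMap) z := by
  have : IsManifold I 1 N := .of_le (n := ∞) (by simp)
  set φ := extChartAt I z with hφ
  set G : E → ℝ := F ∘ φ.symm with hG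
  have hGs : ContDiffAt ℝ ∞ G (φ z) := by
    have := (contMDiffAt_iff_contDiffAt (n := ∞) (f := G) (x := φ z) (𝕜 := ℝ)).1 ?_
    · exact this
    · apply ContMDiffAt.comp (I' := I)
      · simpa [hφ] using hF
      · exact (contMDiffOn_extChartAt_symm z).contMDiffAt (extChartAt_target_mem_nhds z)
  have hφs : ∀ {y}, y ∈ (chartAt H z).source → MDifferentiableAt I 𝓘(ℝ, E) φ y := fun hy =>
    mdifferentiableAt_extChartAt hy
  have hφz : ContMDiffAt I 𝓘(ℝ, E) ∞ φ z := contMDiffAt_extChartAt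
  have hGd : ∀ᶠ u in 𝓝 (φ z), DifferentiableAt ℝ G u := by
    filter_upwards [(hGs.of_le (m := 1) (by simp)).eventually (by simp)] with u hu
    exact hu.differentiableAt (by simp)
  have hsrc : (chartAt H z).source ∈ 𝓝 z := chart_source_mem_nhds H z
  have hFG : ∀ y ∈ (chartAt H z).source, F y = G (φ y) := fun y hy => by
    simp only [hG, Function.comp]
    rw [φ.left_inv (by simpa [hφ] using hy)]
  have hFd : ∀ᶠ y in 𝓝 z, ∀ v, mvfderiv I F y v = fderiv ℝ G (φ y) (mvfderiv I φ y v) := by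
    filter_upwards [hφz.continuousAt.eventually hGd, eventually_mem_nhds_iff.2 hsrc] with y hy hy' v
    rw [← mvfderiv_comp_fderiv (hφs (mem_of_mem_nhds hy')) hy]
    exact congrArg (fun L => L v) (mvfderiv_congr (by filter_upwards [hy'] using hFG))
  have hexp : ∀ (L : E →L[ℝ] ℝ) {y : N}, y ∈ (chartAt H z).source → ∀ v : TangentSpace I y,
      L (mvfderiv I φ y v) = ∑ a, L (b a) *
        mvfderiv I (extendCovector I z (b.coord a).toContinuousLinearMap) y v := by
    intro L y hy v
    conv_lhs => rw [← b.sum_repr (mvfderiv I φ y v)]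
    simp only [map_sum, map_smul, smul_eq_mul]
    refine Finset.sum_congr rfl fun a _ => ?_
    rw [mvfderiv_extendCovector z _ hy]
    simp [mul_comm]
    left; rfl
  have hG' : ContDiffAt ℝ ∞ (fderiv ℝ G) (φ z) := hGs.fderiv_right (by simp)
  have hG'd : DifferentiableAt ℝ (fderiv ℝ G) (φ z) := hG'.differentiableAt (by simp)
  -- The witnesses are the first partial derivatives of the chart representative `G` along the
  -- basis, and its Hessian at `φ z`; `S` is symmetric by equality of mixed partials.
  refine ⟨fun a y => fderiv ℝ G (φ y) (b a), fun a c => fderiv ℝ (fderiv ℝ G) (φ z) (b c) (b a),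
    fun a => ?_, ?_, fun a => ?_, fun a c => ?_, fun a => ?_⟩
  · have h1 : ContDiffAt ℝ ∞ (fun u => fderiv ℝ G u (b a)) (φ z) := hG'.clm_apply contDiffAt_const
    exact h1.contMDiffAt.comp z hφz
  · filter_upwards [hFd, hsrc] with y hy hy'
    ext v
    rw [hy, hexp _ hy']
    simp
  · have h1 := hFd.self_of_nhds (show TangentSpace I z from b a)
    rw [mvfderiv_extChartAt_self] at h1
    exact h1.symm
  · have := (hGs.isSymmSndFDerivAt (by simpa using WithTop.coe_le_coe.2 (le_top : (2 : ℕ∞) ≤ ⊤)))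
    exact this _ _
  · ext v
    have h1 : DifferentiableAt ℝ (fun u => fderiv ℝ G u (b a)) (φ z) :=
      hG'd.clm_apply (differentiableAt_const _)
    rw [mvfderiv_comp_fderiv (hφs (mem_chart_source H z)) h1,
      hexp _ (mem_chart_source H z), ]
    simp only [sum_apply, smul_apply, smul_eq_mul]
    refine Finset.sum_congr rfl fun c _ => ?_
    congr 1
    rw [fderiv_clm_apply hG'd (differentiableAt_const _)]
    simp

end General

/-! ### Alternating fields and tensoriality of the Lie derivative. -/

section General
open Filter Topology
variable {E : Type*} [NormedAddCommGroup E] [NormedSpace ℝ E]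
  {H : Type*} [TopologicalSpace H] {I : ModelWithCorners ℝ E H}
  {N : Type*} [TopologicalSpace N] [ChartedSpace H N]

/-- Pointwise bilinear and alternating families of functions of two covectors. -/
structure IsAlternatingField (W : BiField I N) : Prop where
  add_left : ∀ (z : N) (Φ Φ' Ψ : Covector I z), W z (Φ + Φ') Ψ = W z Φ Ψ + W z Φ' Ψ
  smul_left : ∀ (z : N) (c : ℝ) (Φ Ψ : Covector I z), W z (c • Φ) Ψ = c * W z Φ Ψ
  skew : ∀ (z : N) (Φ Ψ : Covector I z), W z Φ Ψ = -W z Ψ Φ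

theorem PoissonLift.IsBivectorField.isAlternatingField {W : BiField I N}
    (h : IsBivectorField I W) : IsAlternatingField W :=
  ⟨h.add_left, h.smul_left, h.skew⟩

namespace IsAlternatingField

variable {W : BiField I N} (hW : IsAlternatingField W)
include hW

/-- The bilinear form at a point. -/
noncomputable def bilin (z : N) : Covector I z →ₗ[ℝ] Covector I z →ₗ[ℝ] ℝ :=
  LinearMap.mk₂ ℝ (W z) (hW.add_left z) (hW.smul_left z)
    (fun Φ Ψ Ψ' => by
      rw [hW.skew, hW.add_left, neg_add, ← hW.skew, ← hW.skew])
    (fun c Φ Ψ => by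
      rw [hW.skew, hW.smul_left, ← mul_neg, ← hW.skew, smul_eq_mul])

theorem bilin_apply (z : N) (Φ Ψ : Covector I z) : hW.bilin z Φ Ψ = W z Φ Ψ := rfl

theorem zero_left (z : N) (Ψ : Covector I z) : W z 0 Ψ = 0 := by
  simp [← hW.bilin_apply]

theorem add_right (z : N) (Φ Ψ Ψ' : Covector I z) : W z Φ (Ψ + Ψ') = W z Φ Ψ + W z Φ Ψ' := by
  simp [← hW.bilin_apply]

theorem smul_right (z : N) (c : ℝ) (Φ Ψ : Covector I z) : W z Φ (c • Ψ) = c * W z Φ Ψ := by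
  simp [← hW.bilin_apply]

theorem sum_left {ι : Type*} (s : Finset ι) (z : N) (Φ : ι → Covector I z) (Ψ : Covector I z) :
    W z (∑ i ∈ s, Φ i) Ψ = ∑ i ∈ s, W z (Φ i) Ψ := by
  simp [← hW.bilin_apply]

theorem sum_right {ι : Type*} (s : Finset ι) (z : N) (Φ : Covector I z) (Ψ : ι → Covector I z) :
    W z Φ (∑ i ∈ s, Ψ i) = ∑ i ∈ s, W z Φ (Ψ i) := by
  simp [← hW.bilin_apply]

theorem bracket_skew (F G : N → ℝ) (z : N) : bracket I W F G z = -bracket I W G F z :=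
  hW.skew _ _ _

end IsAlternatingField

theorem bracket_congr {W : BiField I N} {F F' G G' : N → ℝ} {z : N} (hF : F =ᶠ[𝓝 z] F')
    (hG : G =ᶠ[𝓝 z] G') : bracket I W F G =ᶠ[𝓝 z] bracket I W F' G' := by
  filter_upwards [eventually_eventually_nhds.2 hF, eventually_eventually_nhds.2 hG] with y h1 h2
  simp only [bracket]
  rw [mvfderiv_congr h1, mvfderiv_congr h2]

variable (I) in
/-- Smoothness of a bivector field at a point. -/
def SmoothBiFieldAt (W : BiField I N) (z : N) : Prop :=
  ∀ F G : N → ℝ, ContMDiffAt I 𝓘(ℝ, ℝ) ∞ F z → ContMDiffAt I 𝓘(ℝ, ℝ) ∞ G z →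
    ContMDiffAt I 𝓘(ℝ, ℝ) ∞ (bracket I W F G) z

variable (I) in
/-- Smoothness of a vector field at a point, as a derivation. -/
def SmoothFieldAt (K : ∀ z : N, TangentSpace I z) (z : N) : Prop :=
  ∀ F : N → ℝ, ContMDiffAt I 𝓘(ℝ, ℝ) ∞ F z →
    ContMDiffAt I 𝓘(ℝ, ℝ) ∞ (fun y => mvfderiv I F y (K y)) z

variable (I) in
/-- `K(W(dF, dG)) - W(d(K F), dG) - W(dF, d(K G))`. -/
noncomputable def lieExpr (K : ∀ z : N, TangentSpace I z) (W : BiField I N) (F G : N → ℝ) (z : N) :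
    ℝ :=
  mvfderiv I (bracket I W F G) z (K z)
    - W z (mvfderiv I (fun y => mvfderiv I F y (K y)) z) (mvfderiv I G z)
    - W z (mvfderiv I F z) (mvfderiv I (fun y => mvfderiv I G y (K y)) z)

variable {W : BiField I N} {K : ∀ z : N, TangentSpace I z} {z : N}

theorem lieExpr_skew (hW : IsAlternatingField W) (F G : N → ℝ) :
    lieExpr I K W F G z = -lieExpr I K W G F z := by
  have h : bracket I W F G = fun y => -bracket I W G F y := funext fun y => hW.bracket_skew F G y
  have h1 : mvfderiv I (bracket I W F G) z = -mvfderiv I (bracket I W G F) z := by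
    rw [h]; exact mvfderiv_neg
  simp only [lieExpr]
  rw [h1, hW.skew z (mvfderiv I F z), hW.skew z _ (mvfderiv I G z)]
  simp
  ring

/-- No nondegeneracy is involved: in finite dimension every linear form on covectors is evaluation
at a vector, so the choice in `sharp` has a solution. -/
theorem apply_sharp [FiniteDimensional ℝ E] (hW : IsAlternatingField W) (z : N) (Φ Ψ : Covector I z) :
    Ψ (sharp I W z Φ) = W z Φ Ψ := by
  refine Classical.epsilon_spec (p := fun v => ∀ Ψ : Covector I z, Ψ v = W z Φ Ψ) ?_ Ψ
  let B : (E →L[ℝ] ℝ) →ₗ[ℝ] ℝ := hW.bilin z Φ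
  let b := Module.finBasis ℝ E
  refine ⟨(∑ a, B (b.coord a).toContinuousLinearMap • b a : E), fun Ψ => ?_⟩
  let ℓ : E →L[ℝ] ℝ := Ψ
  have h : ℓ = ∑ a, ℓ (b a) • (b.coord a).toContinuousLinearMap := by
    ext v
    conv_lhs => rw [← b.sum_repr v]
    simp only [map_sum, map_smul, smul_eq_mul, sum_apply, smul_apply]
    exact Finset.sum_congr rfl fun a _ => mul_comm _ _
  change ℓ _ = B ℓ
  conv_rhs => rw [h]
  simp [mul_comm]

theorem lieExpr_contMDiffAt (hWs : SmoothBiFieldAt I W z)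
    (hK : SmoothFieldAt I K z) {F G : N → ℝ} (hF : ContMDiffAt I 𝓘(ℝ, ℝ) ∞ F z)
    (hG : ContMDiffAt I 𝓘(ℝ, ℝ) ∞ G z) : ContMDiffAt I 𝓘(ℝ, ℝ) ∞ (lieExpr I K W F G) z :=
  ((hK _ (hWs F G hF hG)).sub (hWs _ G (hK F hF) hG)).sub (hWs F _ hF (hK G hG))

variable [IsManifold I ∞ N]

theorem lieDerivative_eq_lieExpr (Φ Ψ : Covector I z) :
    lieDerivative I K W z Φ Ψ =
      lieExpr I K W (extendCovector I z Φ) (extendCovector I z Ψ) z := by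
  simp only [lieDerivative, lieExpr, mvfderiv_extendCovector_self]

/-- The combination `F + c F'` serves twice: it yields additivity and homogeneity of
`lieDerivative`, and with `c = -1` it reduces tensoriality to functions with zero differential. -/
theorem lieExpr_add_mul_left (hW : IsAlternatingField W) (hWs : SmoothBiFieldAt I W z)
    (hK : SmoothFieldAt I K z) {F F' G : N → ℝ} (c : ℝ) (hF : ContMDiffAt I 𝓘(ℝ, ℝ) ∞ F z)
    (hF' : ContMDiffAt I 𝓘(ℝ, ℝ) ∞ F' z) (hG : ContMDiffAt I 𝓘(ℝ, ℝ) ∞ G z) :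
    lieExpr I K W (fun y => F y + c * F' y) G z =
      lieExpr I K W F G z + c * lieExpr I K W F' G z := by
  have key : ∀ {A B : N → ℝ} {y : N}, MDifferentiableAt I 𝓘(ℝ, ℝ) A y →
      MDifferentiableAt I 𝓘(ℝ, ℝ) B y →
      mvfderiv I (fun y => A y + c * B y) y = mvfderiv I A y + c • mvfderiv I B y := by
    intro A B y hA hB
    have h1 : MDifferentiableAt I 𝓘(ℝ, ℝ) (fun y => c * B y) y := mdifferentiableAt_const.mul hB
    rw [mvfderiv_fun_add hA h1, mvfderiv_fun_mul mdifferentiableAt_const hB]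
    simp [mvfderiv_const]
  have hd : ∀ᶠ y in 𝓝 z, mvfderiv I (fun y => F y + c * F' y) y =
      mvfderiv I F y + c • mvfderiv I F' y := by
    filter_upwards [hF.eventually_mdiff, hF'.eventually_mdiff] with y h1 h2 using key h1 h2
  have hb : bracket I W (fun y => F y + c * F' y) G =ᶠ[𝓝 z]
      fun y => bracket I W F G y + c * bracket I W F' G y := by
    filter_upwards [hd] with y h
    simp only [bracket, h, hW.add_left, hW.smul_left]
  have hKF : (fun y => mvfderiv I (fun y => F y + c * F' y) y (K y)) =ᶠ[𝓝 z]
      fun y => mvfderiv I F y (K y) + c * mvfderiv I F' y (K y) := by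
    filter_upwards [hd] with y h
    simp [h]
  simp only [lieExpr]
  rw [mvfderiv_congr hb, mvfderiv_congr hKF, hd.self_of_nhds,
    key (hWs F G hF hG).mdiff (hWs F' G hF' hG).mdiff, key (hK F hF).mdiff (hK F' hF').mdiff]
  simp only [hW.add_left, hW.smul_left, add_apply, smul_apply, smul_eq_mul]
  ring

theorem lieDerivative_isAlternatingField (hW : IsAlternatingField W)
    (hWs : ∀ z, SmoothBiFieldAt I W z) (hK : ∀ z, SmoothFieldAt I K z) :
    IsAlternatingField (lieDerivative I K W) := by
  have hs : ∀ (z : N) (ℓ : E →L[ℝ] ℝ), ContMDiffAt I 𝓘(ℝ, ℝ) ∞ (extendCovector I z ℓ) z :=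
    fun z ℓ => contMDiffAt_extendCovector z _ (mem_chart_source H z)
  have h1 : ∀ (z : N) (c : ℝ) (Φ Φ' Ψ : Covector I z), lieDerivative I K W z (Φ + c • Φ') Ψ =
      lieDerivative I K W z Φ Ψ + c * lieDerivative I K W z Φ' Ψ := fun z c Φ Φ' Ψ => by
    simp only [lieDerivative_eq_lieExpr]
    -- `extendCovector` is linear in the covector by definition, so linearity in the function
    -- applies as it stands.
    exact lieExpr_add_mul_left hW (hWs z) (hK z) c (hs z Φ) (hs z Φ') (hs z Ψ)
  have h0 : ∀ (z : N) (Ψ : Covector I z), lieDerivative I K W z 0 Ψ = 0 := fun z Ψ => by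
    have := h1 z 1 0 0 Ψ
    simp only [smul_zero, add_zero] at this
    linarith
  refine ⟨fun z Φ Φ' Ψ => ?_, fun z c Φ Ψ => ?_, fun z Φ Ψ => ?_⟩
  · simpa using h1 z 1 Φ Φ' Ψ
  · simpa [h0] using h1 z c 0 Φ Ψ
  · rw [lieDerivative_eq_lieExpr, lieExpr_skew hW, ← lieDerivative_eq_lieExpr]

variable [FiniteDimensional ℝ E] [I.Boundaryless]

/-- Near z the bracket of any two smooth functions is a combination, with smooth coefficients, of
brackets of the chart coordinates at z. -/
theorem smoothBiFieldAt_of_coordinates (hW : IsAlternatingField W)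
    (h : ∀ ℓ ℓ' : E →L[ℝ] ℝ, ContMDiffAt I 𝓘(ℝ, ℝ) ∞
      (bracket I W (extendCovector I z ℓ) (extendCovector I z ℓ')) z) : SmoothBiFieldAt I W z := by
  intro F G hF hG
  let b := Module.finBasis ℝ E
  obtain ⟨D, S, hD, hd, -⟩ := exists_coordinate_expansion b hF
  obtain ⟨D', S', hD', hd', -⟩ := exists_coordinate_expansion b hG
  set x : Fin (Module.finrank ℝ E) → N → ℝ :=
    fun a => extendCovector I z (b.coord a).toContinuousLinearMap with hx
  have he : bracket I W F G =ᶠ[𝓝 z] fun y =>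
      ∑ a, ∑ c, D a y * (D' c y * bracket I W (x a) (x c) y) := by
    filter_upwards [hd, hd'] with y h1 h2
    simp only [bracket, h1, h2, hW.sum_left, hW.smul_left, hW.sum_right, hW.smul_right,
      Finset.mul_sum, hx]
  refine ContMDiffAt.congr_of_eventuallyEq ?_ he
  refine ContMDiffAt.sum fun a _ => ContMDiffAt.sum fun c _ => ?_
  exact (hD a).mul ((hD' c).mul (h _ _))

theorem smoothFieldAt_of_coordinates
    (h : ∀ ℓ : E →L[ℝ] ℝ, ContMDiffAt I 𝓘(ℝ, ℝ) ∞
      (fun y => mvfderiv I (extendCovector I z ℓ) y (K y)) z) : SmoothFieldAt I K z := by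
  intro F hF
  let b := Module.finBasis ℝ E
  obtain ⟨D, S, hD, hd, -⟩ := exists_coordinate_expansion b hF
  have he : (fun y => mvfderiv I F y (K y)) =ᶠ[𝓝 z] fun y =>
      ∑ a, D a y * mvfderiv I (extendCovector I z (b.coord a).toContinuousLinearMap) y (K y) := by
    filter_upwards [hd] with y h1
    simp [h1]
  refine ContMDiffAt.congr_of_eventuallyEq ?_ he
  exact ContMDiffAt.sum fun a _ => (hD a).mul (h _)

/-- Tensoriality. Near z, dF = Σ D_a dx_a with all D_a zero at z, so at z the first term is Σ K(D_a)
{x_a, G} and the second is Σ K(x_a) {D_a, G}. As dD_a = Σ S_{ac} dx_c, both are contractions of S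
with the same two families, and they agree because S is symmetric. The third term contains dF = 0.
-/
theorem lieExpr_eq_zero (hW : IsAlternatingField W) (hWs : SmoothBiFieldAt I W z)
    (hK : SmoothFieldAt I K z) {F G : N → ℝ} (hF : ContMDiffAt I 𝓘(ℝ, ℝ) ∞ F z)
    (hG : ContMDiffAt I 𝓘(ℝ, ℝ) ∞ G z) (h0 : mvfderiv I F z = 0) :
    lieExpr I K W F G z = 0 := by
  let b := Module.finBasis ℝ E
  obtain ⟨D, S, hD, hd, hD0, hS, hdD⟩ := exists_coordinate_expansion b hF
  set x : Fin (Module.finrank ℝ E) → N → ℝ :=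
    fun a => extendCovector I z (b.coord a).toContinuousLinearMap with hx
  have hxs : ∀ a, ContMDiffAt I 𝓘(ℝ, ℝ) ∞ (x a) z := fun a =>
    contMDiffAt_extendCovector z _ (mem_chart_source H z)
  have hD0' : ∀ a, D a z = 0 := fun a => by rw [hD0, h0]; rfl
  have hb : bracket I W F G =ᶠ[𝓝 z] fun y => ∑ a, D a y * bracket I W (x a) G y := by
    filter_upwards [hd] with y h1
    simp only [bracket, h1, hW.sum_left, hW.smul_left, hx]
  have hKF : (fun y => mvfderiv I F y (K y)) =ᶠ[𝓝 z]
      fun y => ∑ a, D a y * mvfderiv I (x a) y (K y) := by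
    filter_upwards [hd] with y h1
    simp [h1, hx]
  simp only [lieExpr]
  rw [mvfderiv_congr hb, mvfderiv_congr hKF, h0, hW.zero_left,
    mvfderiv_sum_mul _ (fun a _ => (hD a).mdiff) (fun a _ => (hWs _ G (hxs a) hG).mdiff),
    mvfderiv_sum_mul _ (fun a _ => (hD a).mdiff) (fun a _ => (hK _ (hxs a)).mdiff)]
  simp only [hD0', zero_smul, zero_add, hdD, hW.sum_left, hW.smul_left, sum_apply, smul_apply,
    smul_eq_mul, sub_zero, Finset.mul_sum, bracket]
  rw [sub_eq_zero, Finset.sum_comm]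
  refine Finset.sum_congr rfl fun a _ => Finset.sum_congr rfl fun c _ => ?_
  rw [hS]
  ring

/-- The formula for `L_K W` holds for all smooth functions. -/
theorem lieDerivative_mvfderiv (hW : IsAlternatingField W) (hWs : SmoothBiFieldAt I W z)
    (hK : SmoothFieldAt I K z) {F G : N → ℝ} (hF : ContMDiffAt I 𝓘(ℝ, ℝ) ∞ F z)
    (hG : ContMDiffAt I 𝓘(ℝ, ℝ) ∞ G z) :
    lieDerivative I K W z (mvfderiv I F z) (mvfderiv I G z) = lieExpr I K W F G z := by
  -- The first slot depends on the differential alone, since `F - F'` has zero differential; the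
  -- second slot follows by skew-symmetry.
  have main : ∀ {F F' G : N → ℝ}, ContMDiffAt I 𝓘(ℝ, ℝ) ∞ F z → ContMDiffAt I 𝓘(ℝ, ℝ) ∞ F' z →
      ContMDiffAt I 𝓘(ℝ, ℝ) ∞ G z → mvfderiv I F z = mvfderiv I F' z →
      lieExpr I K W F G z = lieExpr I K W F' G z := by
    intro F F' G hF hF' hG h
    have h1 := lieExpr_add_mul_left hW hWs hK (-1) hF hF' hG
    have h3 := lieExpr_eq_zero (F := fun y => F y + -1 * F' y) hW hWs hK
      (hF.add (contMDiffAt_const.mul hF')) hG ?_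
    · linarith
    · have h2 : MDifferentiableAt I 𝓘(ℝ, ℝ) (fun y => -1 * F' y) z :=
        mdifferentiableAt_const.mul hF'.mdiff
      rw [mvfderiv_fun_add hF.mdiff h2, mvfderiv_fun_mul mdifferentiableAt_const hF'.mdiff, h]
      simp [mvfderiv_const]
  have hs : ∀ ℓ : E →L[ℝ] ℝ, ContMDiffAt I 𝓘(ℝ, ℝ) ∞ (extendCovector I z ℓ) z := fun ℓ =>
    contMDiffAt_extendCovector z _ (mem_chart_source H z)
  have h1 := main (hs (mvfderiv I F z)) hF (hs (mvfderiv I G z))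
    (mvfderiv_extendCovector_self z (mvfderiv I F z))
  have h2 := main (hs (mvfderiv I G z)) hG hF (mvfderiv_extendCovector_self z (mvfderiv I G z))
  rw [lieDerivative_eq_lieExpr, h1, lieExpr_skew hW, h2, ← lieExpr_skew hW]

end General

/-! ### Chart-constant extensions of tangent vectors commute. -/

section ConstantFields
open Filter Topology
variable {E : Type*} [NormedAddCommGroup E] [NormedSpace ℝ E]

/-- The constant vector field on a normed space. -/
def constField (v y : E) : TangentSpace 𝓘(ℝ, E) y := v

theorem constField_smooth (v y : E) :
    ContMDiffAt 𝓘(ℝ, E) (𝓘(ℝ, E)).tangent ∞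
      (fun y => (⟨y, constField v y⟩ : TangentBundle 𝓘(ℝ, E) E)) y :=
  contMDiffAt_vectorSpace_iff_contDiffAt.2 contDiffAt_const

theorem mlieBracket_constField (u v : E) :
    VectorField.mlieBracket 𝓘(ℝ, E) (constField u) (constField v) = 0 := by
  rw [← VectorField.mlieBracketWithin_univ, VectorField.mlieBracketWithin_eq_lieBracketWithin]
  ext1 y
  have h : ∀ v : E, fderivWithin ℝ (fun y : E => v) Set.univ y = 0 := fun v => by simp
  exact (sub_eq_zero (G := E)).2
    ((congrArg (fun L => L u) (h v)).trans (congrArg (fun L => L v) (h u)).symm)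

variable {H : Type*} [TopologicalSpace H] {I : ModelWithCorners ℝ E H}
  {N : Type*} [TopologicalSpace N] [ChartedSpace H N] [IsManifold I 1 N]

/-- `FiberBundle.extend` is constant in the tangent trivialization at z, and that trivialization is
the derivative of the chart. -/
theorem mvfderiv_extChartAt_extend {z y : N} (hy : y ∈ (chartAt H z).source)
    (v : TangentSpace I z) :
    mvfderiv I (extChartAt I z) y (FiberBundle.extend E v y) = (show E from v) := by
  have h1 := congrArg (fun L => L (FiberBundle.extend E v y))
    (TangentBundle.continuousLinearMapAt_trivializationAt (I := I) hy)
  have h2 := congrArg (fun L => L v)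
    (TangentBundle.continuousLinearMapAt_trivializationAt (I := I) (mem_chart_source H z))
  refine h1.symm.trans ?_
  have h3 := mfderiv_extChartAt_self (I := I) (x := z)
  have hb : y ∈ (trivializationAt E (TangentSpace I) z).baseSet := by simpa using hy
  have hz : z ∈ (trivializationAt E (TangentSpace I) z).baseSet := by simp
  have h4 : FiberBundle.extend E v y = (trivializationAt E (TangentSpace I) z).symmL ℝ y
      ((trivializationAt E (TangentSpace I) z).continuousLinearMapAt ℝ z v) := by
    rw [Trivialization.continuousLinearMapAt_apply, Trivialization.linearMapAt_apply, if_pos hz,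
      Trivialization.symmL_apply _ hb]
    rfl
  simp only [h4]
  rw [Trivialization.continuousLinearMapAt_symmL _ hb]
  refine h2.trans ?_
  exact congrArg (fun L => (show TangentSpace I z →L[ℝ] E from L) v) h3

theorem extend_eq_mpullback {z y : N} (hy : y ∈ (chartAt H z).source)
    (v : TangentSpace I z) :
    FiberBundle.extend E v y =
      VectorField.mpullback I 𝓘(ℝ, E) (extChartAt I z) (constField (show E from v)) y := by
  obtain ⟨L, hL⟩ := isInvertible_mfderiv_extChartAt (I := I) (x := z) (y := y) (by simpa using hy)
  apply L.injective
  rw [VectorField.mpullback_apply, ← hL, ContinuousLinearMap.inverse_equiv]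
  refine Eq.trans ?_ (L.apply_symm_apply _).symm
  refine Eq.trans ?_ (mvfderiv_extChartAt_extend hy v)
  exact congrArg (fun L => L (FiberBundle.extend E v y)) hL

/-- Near z both fields are pullbacks of constant fields by the chart, and the Lie bracket commutes
with pullback. This removes the bracket term from `extDerivOneForm`. -/
theorem mlieBracket_extend [CompleteSpace E] [IsManifold I ∞ N] (z : N) (u v : TangentSpace I z) :
    VectorField.mlieBracket I (FiberBundle.extend E u) (FiberBundle.extend E v) z = 0 := by
  have : IsManifold I (minSmoothness ℝ 3) N := .of_le (n := ∞)
    (by simpa using WithTop.coe_le_coe.2 (le_top : (3 : ℕ∞) ≤ ⊤))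
  have hc : ∀ v : E, MDifferentiableAt 𝓘(ℝ, E) (𝓘(ℝ, E)).tangent
      (fun y => (⟨y, constField v y⟩ : TangentBundle 𝓘(ℝ, E) E)) (extChartAt I z z) :=
    fun i => ContMDiffAt.mdifferentiableAt (constField_smooth i _) (by simp)
  have key : ∀ u v : E, VectorField.mlieBracket I
      (VectorField.mpullback I 𝓘(ℝ, E) (extChartAt I z) (constField u))
      (VectorField.mpullback I 𝓘(ℝ, E) (extChartAt I z) (constField v)) z = 0 := fun u v => by
    rw [← VectorField.mpullback_mlieBracket (n := ∞) (hc u) (hc v) contMDiffAt_extChartAt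
      (by simpa using WithTop.coe_le_coe.2 (le_top : (2 : ℕ∞) ≤ ⊤)), mlieBracket_constField]
    exact map_zero _
  have h' : ∀ v : TangentSpace I z,
      (FiberBundle.extend E v : ∀ y : N, TangentSpace I y) =ᶠ[𝓝 z]
        VectorField.mpullback I 𝓘(ℝ, E) (extChartAt I z) (constField (show E from v)) := fun v => by
    filter_upwards [chart_source_mem_nhds H z] with y hy using extend_eq_mpullback hy v
  exact ((h' u).mlieBracket_vectorField_eq (h' v)).trans (key u v)

end ConstantFields

/-! ### Coordinate fields and smooth sections on the base. -/

section Base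
open Filter Topology
variable {n : ℕ} {M : Type*} [TopologicalSpace M] [ChartedSpace (EuclideanSpace ℝ (Fin n)) M]

variable (M) in
/-- A chart of the smooth structure. -/
def IsSmoothChart (e : OpenPartialHomeomorph M (EuclideanSpace ℝ (Fin n))) : Prop :=
  e ∈ IsManifold.maximalAtlas (𝓡 n) ∞ M

/-- The `i`-th coordinate of a chart. -/
def coordFun (e : OpenPartialHomeomorph M (EuclideanSpace ℝ (Fin n))) (i : Fin n) : M → ℝ :=
  fun x => e x i

/-- The coordinate vector fields of a chart. -/
noncomputable def coordField (e : OpenPartialHomeomorph M (EuclideanSpace ℝ (Fin n))) (i : Fin n) (x : M) :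
    TangentSpace (𝓡 n) x :=
  (mvfderiv (𝓡 n) e x).inverse (EuclideanSpace.single i (1 : ℝ))

variable {e : OpenPartialHomeomorph M (EuclideanSpace ℝ (Fin n))} {x : M}

theorem IsSmoothChart.contMDiffAt (he : IsSmoothChart M e) (hx : x ∈ e.source) :
    ContMDiffAt (𝓡 n) 𝓘(ℝ, EuclideanSpace ℝ (Fin n)) ∞ e x :=
  contMDiffAt_of_mem_maximalAtlas he hx

theorem IsSmoothChart.coordFun_contMDiffAt (he : IsSmoothChart M e) (hx : x ∈ e.source) (i : Fin n) :
    ContMDiffAt (𝓡 n) 𝓘(ℝ, ℝ) ∞ (coordFun e i) x :=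
  ((EuclideanSpace.proj (𝕜 := ℝ) i).contDiff.contMDiff.contMDiffAt).comp x (he.contMDiffAt hx)

theorem IsSmoothChart.isInvertible (he : IsSmoothChart M e) (hx : x ∈ e.source) :
    (mvfderiv (𝓡 n) e x).IsInvertible := by
  have h1 := contMDiffAt_of_mem_maximalAtlas he hx
  have h2 := contMDiffAt_symm_of_mem_maximalAtlas he (e.map_source hx)
  have h3 : OpenPartialHomeomorph.MDifferentiable (𝓡 n) 𝓘(ℝ, EuclideanSpace ℝ (Fin n)) e := by
    constructor
    · exact fun y hy => (contMDiffAt_of_mem_maximalAtlas he hy).mdiff.mdifferentiableWithinAt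
    · exact fun y hy => ((contMDiffAt_symm_of_mem_maximalAtlas he hy).mdifferentiableAt
        (by simp)).mdifferentiableWithinAt
  exact ⟨h3.mfderiv hx, rfl⟩

theorem IsSmoothChart.mvfderiv_coordFun (he : IsSmoothChart M e) (hx : x ∈ e.source) (i : Fin n)
    (v : TangentSpace (𝓡 n) x) :
    mvfderiv (𝓡 n) (coordFun e i) x v = mvfderiv (𝓡 n) e x v i := by
  have := mvfderiv_comp_fderiv (L := EuclideanSpace.proj (𝕜 := ℝ) i) (he.contMDiffAt hx).mdiff
    (ContinuousLinearMap.differentiableAt _) v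
  rw [ContinuousLinearMap.fderiv] at this
  exact this

theorem IsSmoothChart.mvfderiv_coordField (he : IsSmoothChart M e) (hx : x ∈ e.source) (i : Fin n) :
    mvfderiv (𝓡 n) e x (coordField e i x) = EuclideanSpace.single i (1 : ℝ) := by
  obtain ⟨L, hL⟩ := he.isInvertible hx
  simp only [coordField]
  rw [← hL, ContinuousLinearMap.inverse_equiv]
  simp

theorem IsSmoothChart.mvfderiv_coordFun_coordField (he : IsSmoothChart M e) (hx : x ∈ e.source)
    (i j : Fin n) :
    mvfderiv (𝓡 n) (coordFun e j) x (coordField e i x) = if j = i then 1 else 0 := by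
  rw [he.mvfderiv_coordFun hx, he.mvfderiv_coordField hx]
  simp

theorem IsSmoothChart.eq_sum_coordField (he : IsSmoothChart M e) (hx : x ∈ e.source)
    (v : TangentSpace (𝓡 n) x) :
    v = ∑ i, mvfderiv (𝓡 n) (coordFun e i) x v • coordField e i x := by
  obtain ⟨L, hL⟩ := he.isInvertible hx
  have hinj : Function.Injective (mvfderiv (𝓡 n) e x) := by
    rw [← hL]; exact L.injective
  apply hinj
  rw [map_sum]
  simp only [map_smul, he.mvfderiv_coordField hx, he.mvfderiv_coordFun hx]
  ext j
  simp [Pi.single_apply]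

theorem IsSmoothChart.coordField_eq_mpullback (he : IsSmoothChart M e) (hx : x ∈ e.source)
    (i : Fin n) : VectorField.mpullback (𝓡 n) 𝓘(ℝ, EuclideanSpace ℝ (Fin n)) e (constField (EuclideanSpace.single i (1 : ℝ))) x =
      coordField e i x := by
  obtain ⟨L, hL⟩ := he.isInvertible hx
  let L' : TangentSpace (𝓡 n) x ≃L[ℝ] TangentSpace 𝓘(ℝ, EuclideanSpace ℝ (Fin n)) (e x) :=
    L.trans (NormedSpace.fromTangentSpace (e x)).symm
  have hL' : (L' : _ →L[ℝ] _) = mfderiv (𝓡 n) 𝓘(ℝ, EuclideanSpace ℝ (Fin n)) e x := by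
    ext1 v
    exact congrArg (fun L => L v) hL
  rw [VectorField.mpullback_apply, coordField, ← hL, ← hL', ContinuousLinearMap.inverse_equiv,
    ContinuousLinearMap.inverse_equiv]
  rfl

/-- In the chart this is equality of mixed partials of `f ∘ e.symm`. It expresses that coordinate
fields commute and later gives {p_i, p_j} = 0 in every chart. -/
theorem IsSmoothChart.mvfderiv_coordField_comm (he : IsSmoothChart M e) (hx : x ∈ e.source)
    {f : M → ℝ} (hf : ContMDiffAt (𝓡 n) 𝓘(ℝ, ℝ) ∞ f x) (i j : Fin n) :
    mvfderiv (𝓡 n) (fun y => mvfderiv (𝓡 n) f y (coordField e j y)) x (coordField e i x) =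
      mvfderiv (𝓡 n) (fun y => mvfderiv (𝓡 n) f y (coordField e i y)) x (coordField e j x) := by
  set G : EuclideanSpace ℝ (Fin n) → ℝ := f ∘ e.symm with hG
  have hGs : ContDiffAt ℝ ∞ G (e x) := by
    refine (contMDiffAt_iff_contDiffAt (n := ∞) (f := G) (x := e x) (𝕜 := ℝ)).1 ?_
    refine ContMDiffAt.comp (I' := 𝓡 n) _ ?_ (contMDiffAt_symm_of_mem_maximalAtlas he
      (e.map_source hx))
    rwa [e.left_inv hx]
  have hGd : ∀ᶠ u in 𝓝 (e x), DifferentiableAt ℝ G u := by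
    filter_upwards [(hGs.of_le (m := 1) (by simp)).eventually (by simp)] with u hu
    exact hu.differentiableAt (by simp)
  have hFG : ∀ y ∈ e.source, f y = G (e y) := fun y hy => by
    simp only [hG, Function.comp]
    rw [e.left_inv hy]
  have hsrc := e.open_source.mem_nhds hx
  have hFd : ∀ i, (fun y => mvfderiv (𝓡 n) f y (coordField e i y)) =ᶠ[𝓝 x]
      fun y => fderiv ℝ G (e y) (EuclideanSpace.single i (1 : ℝ)) := fun i => by
    filter_upwards [(he.contMDiffAt hx).continuousAt.eventually hGd,
      eventually_mem_nhds_iff.2 hsrc] with y hy hy'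
    rw [← he.mvfderiv_coordField (mem_of_mem_nhds hy'),
      ← mvfderiv_comp_fderiv (he.contMDiffAt (mem_of_mem_nhds hy')).mdiff hy]
    exact congrArg (fun L => L (coordField e i y)) (mvfderiv_congr (by filter_upwards [hy'] using hFG))
  have hG'd : DifferentiableAt ℝ (fderiv ℝ G) (e x) :=
    (hGs.fderiv_right (m := ∞) (by simp)).differentiableAt (by simp)
  have hd : ∀ i j, mvfderiv (𝓡 n) (fun y => mvfderiv (𝓡 n) f y (coordField e j y)) x
      (coordField e i x) = fderiv ℝ (fderiv ℝ G) (e x) (EuclideanSpace.single i (1 : ℝ))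
        (EuclideanSpace.single j (1 : ℝ)) := fun i j => by
    rw [mvfderiv_congr (hFd j), mvfderiv_comp_fderiv (he.contMDiffAt hx).mdiff
      (L := fun u => fderiv ℝ G u (EuclideanSpace.single j (1 : ℝ)))
      (hG'd.clm_apply (differentiableAt_const _)), he.mvfderiv_coordField hx,
      fderiv_clm_apply hG'd (differentiableAt_const _)]
    simp
  rw [hd, hd]
  exact (hGs.isSymmSndFDerivAt (by simpa using WithTop.coe_le_coe.2 (le_top : (2 : ℕ∞) ≤ ⊤))) _ _

variable [IsManifold (𝓡 n) ∞ M]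

variable (n) in
/-- Smoothness of a vector field at a point, as a section. -/
def SmoothSectionAt (Y : ∀ x : M, TangentSpace (𝓡 n) x) (x : M) : Prop :=
  ContMDiffAt (𝓡 n) (𝓡 n).tangent ∞ (fun x => (⟨x, Y x⟩ : TangentBundle (𝓡 n) M)) x

theorem SmoothSectionAt.congr {Y Y' : ∀ x : M, TangentSpace (𝓡 n) x}
    (hY : SmoothSectionAt n Y x) (h : ∀ᶠ y in 𝓝 x, Y y = Y' y) : SmoothSectionAt n Y' x := by
  refine ContMDiffAt.congr_of_eventuallyEq hY ?_
  filter_upwards [h] with y hy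
  rw [hy]

theorem IsSmoothChart.coordField_smooth (he : IsSmoothChart M e) (hx : x ∈ e.source) (i : Fin n) :
    SmoothSectionAt n (coordField e i) x := by
  have h := ContMDiffAt.mpullback_vectorField_preimage (m := ∞) (n := ∞) (I := 𝓡 n)
    (I' := 𝓘(ℝ, EuclideanSpace ℝ (Fin n))) (f := e) (x₀ := x)
    (constField_smooth (EuclideanSpace.single i (1 : ℝ)) _) (he.contMDiffAt hx) (he.isInvertible hx) (by simp)
  refine SmoothSectionAt.congr h ?_
  filter_upwards [e.open_source.mem_nhds hx] with y hy using he.coordField_eq_mpullback hy i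

theorem SmoothSectionAt.smoothFieldAt {Y : ∀ x : M, TangentSpace (𝓡 n) x}
    (hY : SmoothSectionAt n Y x) : SmoothFieldAt (𝓡 n) Y x := by
  have h1 := (contMDiffAt_totalSpace.1 hY).2
  have : IsManifold (𝓡 n) 1 M := .of_le (n := ∞) (by simp)
  refine smoothFieldAt_of_coordinates fun ℓ => ?_
  have h2 := (ℓ.contDiff.contMDiff.contMDiffAt (n := ∞)).comp x h1
  refine h2.congr_of_eventuallyEq ?_
  filter_upwards [chart_source_mem_nhds (EuclideanSpace ℝ (Fin n)) x] with y hy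
  rw [mvfderiv_extendCovector _ _ hy]
  have h3 := TangentBundle.continuousLinearMapAt_trivializationAt (I := 𝓡 n) hy
  have h4 := congrArg (fun L => L (Y y)) h3
  simp only [Function.comp]
  congr 1
  refine h4.symm.trans ?_
  rw [Trivialization.continuousLinearMapAt_apply, Trivialization.linearMapAt_apply, if_pos]
  simpa using hy

theorem SmoothSectionAt.smul {Y : ∀ x : M, TangentSpace (𝓡 n) x} {f : M → ℝ}
    (hf : ContMDiffAt (𝓡 n) 𝓘(ℝ, ℝ) ∞ f x)
    (hY : SmoothSectionAt n Y x) : SmoothSectionAt n (fun y => f y • Y y) x :=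
  ContMDiffAt.smul_section hf hY

theorem SmoothSectionAt.sum {ι : Type*} {s : Finset ι} {Y : ι → ∀ x : M, TangentSpace (𝓡 n) x}
    (hY : ∀ i ∈ s, SmoothSectionAt n (Y i) x) : SmoothSectionAt n (fun y => ∑ i ∈ s, Y i y) x :=
  ContMDiffAt.sum_section hY

theorem SmoothSectionAt.mdiff {Y : ∀ x : M, TangentSpace (𝓡 n) x} (hY : SmoothSectionAt n Y x) :
    MDifferentiableAt (𝓡 n) (𝓡 n).tangent (fun x => (⟨x, Y x⟩ : TangentBundle (𝓡 n) M)) x :=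
  ContMDiffAt.mdifferentiableAt hY (by simp)

/-! ### Localization by bump functions. -/

section Cutoff

variable [T2Space M]

/-- `IsBivectorField` only tests globally smooth functions, whereas chart coordinates are local.
Multiplying by a bump function supported where f is smooth gives a global function with the same
germ, and the bracket depends only on germs. -/
theorem contMDiffAt_bracket_of_isBivectorField {w : BiField (𝓡 n) M}
    (hw : IsBivectorField (𝓡 n) w) {f g : M → ℝ}
    (hf : ∀ᶠ y in 𝓝 x, ContMDiffAt (𝓡 n) 𝓘(ℝ, ℝ) ∞ f y)
    (hg : ∀ᶠ y in 𝓝 x, ContMDiffAt (𝓡 n) 𝓘(ℝ, ℝ) ∞ g y) :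
    ContMDiffAt (𝓡 n) 𝓘(ℝ, ℝ) ∞ (bracket (𝓡 n) w f g) x := by
  have key : ∀ f : M → ℝ, (∀ᶠ y in 𝓝 x, ContMDiffAt (𝓡 n) 𝓘(ℝ, ℝ) ∞ f y) →
      ∃ f' : M → ℝ, IsSmooth (𝓡 n) f' ∧ f =ᶠ[𝓝 x] f' := by
    intro f hf
    obtain ⟨ψ, -, hψ⟩ := (SmoothBumpFunction.nhds_basis_tsupport (I := 𝓡 n) x).mem_iff.1 hf
    refine ⟨fun y => ψ y * f y, contMDiff_of_tsupport fun y hy => ?_, ?_⟩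
    · exact ψ.contMDiffAt.mul (hψ (tsupport_mul_subset_left hy))
    · filter_upwards [ψ.eventuallyEq_one] with y hy
      simp [hy]
  obtain ⟨f', hf', hff⟩ := key f hf
  obtain ⟨g', hg', hgg⟩ := key g hg
  exact ((hw.smooth f' g' hf' hg') x).congr_of_eventuallyEq (bracket_congr hff hgg)

/-- A bump function makes `Y` globally smooth without changing it near x; the connection is local,
so the covariant derivative is unchanged near x as well. -/
theorem smoothSectionAt_cov
    (cov : CovariantDerivative (𝓡 n) (EuclideanSpace ℝ (Fin n))
      (TangentSpace (𝓡 n) : M → Type _))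
    [hcov : CovariantDerivative.ContMDiffCovariantDerivative cov ∞]
    {X Y : ∀ x : M, TangentSpace (𝓡 n) x} (hX : SmoothSectionAt n X x)
    (hY : ∀ᶠ y in 𝓝 x, SmoothSectionAt n Y y) :
    SmoothSectionAt n (fun y => cov Y y (X y)) x := by
  obtain ⟨U, hU, hUo, hxU⟩ := eventually_nhds_iff.1 hY
  obtain ⟨ψ, -, hψ⟩ := (SmoothBumpFunction.nhds_basis_tsupport (I := 𝓡 n) x).mem_iff.1
    (hUo.mem_nhds hxU)
  have h1 := ContMDiffOn.smul_section_of_tsupport (s := Y) (ψ := ψ) (u := U) (n := ∞) (I := 𝓡 n)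
    (F := EuclideanSpace ℝ (Fin n)) (V := fun x : M => TangentSpace (𝓡 n) x)
    ψ.contMDiff.contMDiffOn hUo hψ fun y hy => ContMDiffAt.contMDiffWithinAt (hU y hy)
  have h2 := hcov.contMDiff.contMDiff (σ := (ψ : M → ℝ) • Y) (by simpa using h1.contMDiffOn)
  have h3 := h2.contMDiffAt (x := x) univ_mem
  have h4 := ContMDiffAt.clm_bundle_apply h3 hX
  refine SmoothSectionAt.congr h4 ?_
  filter_upwards [eventually_eventually_nhds.2 ψ.eventuallyEq_one, hY] with y hy hYy
  have h5 := cov.isCovariantDerivativeOnUniv.congr_of_eventuallyEq (x := y)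
    (σ := (ψ : M → ℝ) • Y) (σ' := Y)
    ((h1 y).mdifferentiableAt (by simp)) hYy.mdiff univ_mem
    (by filter_upwards [hy] with z hz; simp [hz])
  exact congrArg (fun L => L (X y)) h5

/-- The components of ♯_w df in a chart are the brackets {f, x^i}_w. -/
theorem smoothSectionAt_sharp {w : BiField (𝓡 n) M}
    (hw : IsBivectorField (𝓡 n) w) {f : M → ℝ}
    (hf : ∀ᶠ y in 𝓝 x, ContMDiffAt (𝓡 n) 𝓘(ℝ, ℝ) ∞ f y) :
    SmoothSectionAt n (fun y => sharp (𝓡 n) w y (mvfderiv (𝓡 n) f y)) x := by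
  let e := chartAt (EuclideanSpace ℝ (Fin n)) x
  have he : IsSmoothChart M e := IsManifold.chart_mem_maximalAtlas x
  have hx : x ∈ e.source := mem_chart_source _ x
  have h1 : ∀ i ∈ Finset.univ, SmoothSectionAt n
    (fun y => bracket (𝓡 n) w f (coordFun e i) y • coordField e i y) x := fun i _ =>
    SmoothSectionAt.smul (contMDiffAt_bracket_of_isBivectorField hw hf
      (by filter_upwards [e.open_source.mem_nhds hx] with y hy using he.coordFun_contMDiffAt hy i))
      (he.coordField_smooth hx i)
  refine (SmoothSectionAt.sum h1).congr ?_
  filter_upwards [e.open_source.mem_nhds hx] with y hy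
  rw [he.eq_sum_coordField hy (sharp _ _ _ _)]
  simp only [apply_sharp hw.isAlternatingField, bracket]

end Cutoff

end Base

/-! ### Charts of the cotangent bundle, momenta, and dλ in coordinates. -/

section Cotangent
open Filter Topology
variable {n : ℕ} {M : Type*} [TopologicalSpace M] [ChartedSpace (EuclideanSpace ℝ (Fin n)) M]
  [IsManifold (𝓡 n) ∞ M]

theorem contMDiff_projection : ContMDiff (cotangentI n) (𝓡 n) ∞ (proj n M) :=
  Bundle.contMDiff_proj _

theorem eventually_projection {p : M → Prop} {α : CotangentBundle n M}
    (h : ∀ᶠ x in 𝓝 α.proj, p x) : ∀ᶠ β : CotangentBundle n M in 𝓝 α, p β.proj :=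
  (contMDiff_projection (n := n) (M := M)).continuous.continuousAt.eventually h

theorem ContMDiffAt.comp_projection {f : M → ℝ} {α : CotangentBundle n M}
    (hf : ContMDiffAt (𝓡 n) 𝓘(ℝ, ℝ) ∞ f α.proj) :
    ContMDiffAt (cotangentI n) 𝓘(ℝ, ℝ) ∞ (fun β : CotangentBundle n M => f β.proj) α :=
  hf.comp α (contMDiff_projection α)

theorem mvfderiv_comp_projection {f : M → ℝ} {α : CotangentBundle n M}
    (hf : MDifferentiableAt (𝓡 n) 𝓘(ℝ, ℝ) f α.proj) :
    mvfderiv (cotangentI n) (fun β : CotangentBundle n M => f β.proj) α =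
      (mvfderiv (𝓡 n) f α.proj).comp (dproj α) :=
  mvfderiv_comp α hf ((contMDiff_projection α).mdifferentiableAt (by simp))

theorem IsSmoothChart.chartAt (x : M) : IsSmoothChart M (chartAt (EuclideanSpace ℝ (Fin n)) x) :=
  IsManifold.chart_mem_maximalAtlas x

theorem cotangent_mem_chart_source {α β : CotangentBundle n M}
    (hβ : β.proj ∈ (_root_.chartAt (EuclideanSpace ℝ (Fin n)) α.proj).source) :
    β ∈ (_root_.chartAt (ModelProd (EuclideanSpace ℝ (Fin n)) (CotangentModel n)) α).source := by
  rw [FiberBundle.chartedSpace_chartAt]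
  simp only [mfld_simps]
  exact ⟨⟨hβ, Set.mem_univ _⟩, hβ⟩

/-- Links coordinate fields, defined by inverting the derivative of the chart, to the trivialization
from which the charts of T*M are built. -/
theorem coordField_chartAt {x y : M} (hy : y ∈ (chartAt (EuclideanSpace ℝ (Fin n)) x).source)
    (i : Fin n) : coordField (chartAt (EuclideanSpace ℝ (Fin n)) x) i y =
      (trivializationAt (EuclideanSpace ℝ (Fin n)) (TangentSpace (𝓡 n)) x).symmL ℝ y
        (EuclideanSpace.single i (1 : ℝ)) := by
  have : IsManifold (𝓡 n) 1 M := .of_le (n := ∞) (by simp)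
  obtain ⟨L, hL⟩ := (IsSmoothChart.chartAt x).isInvertible hy
  apply L.injective
  have h1 := (IsSmoothChart.chartAt x).mvfderiv_coordField hy i
  rw [← hL] at h1
  refine h1.trans ?_
  have h2 := TangentBundle.continuousLinearMapAt_trivializationAt (I := 𝓡 n) hy
  have hb : y ∈ (trivializationAt (EuclideanSpace ℝ (Fin n)) (TangentSpace (𝓡 n)) x).baseSet :=
    by simpa using hy
  have h3 := Trivialization.continuousLinearMapAt_symmL (R := ℝ) _ hb
    (EuclideanSpace.single i (1 : ℝ))
  rw [h2] at h3
  refine h3.symm.trans ?_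
  exact congrArg (fun L => L ((trivializationAt (EuclideanSpace ℝ (Fin n)) (TangentSpace (𝓡 n)) x).symmL ℝ y
        (EuclideanSpace.single i (1 : ℝ)))) hL.symm

/-- The evaluation of the covector part at a vector. -/
noncomputable def evalSnd (v : EuclideanSpace ℝ (Fin n)) :
    EuclideanSpace ℝ (Fin n) × CotangentModel n →L[ℝ] ℝ :=
  (ContinuousLinearMap.apply ℝ ℝ v).comp (ContinuousLinearMap.snd ℝ _ (CotangentModel n))

/-- The fibre coordinates of the preferred chart of T*M are the momenta p_i: the hom-bundle
trivialization precomposes a covector with `symmL`, which carries the standard basis to the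
coordinate fields. -/
theorem extendCovector_evalSnd {α β : CotangentBundle n M}
    (hβ : β.proj ∈ (chartAt (EuclideanSpace ℝ (Fin n)) α.proj).source) (i : Fin n) :
    extendCovector (cotangentI n) α (evalSnd (EuclideanSpace.single i (1 : ℝ))) β =
      momentum (coordField (chartAt (EuclideanSpace ℝ (Fin n)) α.proj) i) β := by
  have h : extChartAt (cotangentI n) α β = (chartAt (EuclideanSpace ℝ (Fin n)) α.proj β.proj,
      ContinuousLinearMap.inCoordinates (EuclideanSpace ℝ (Fin n)) (TangentSpace (𝓡 n)) ℝ
        (Bundle.Trivial M ℝ) α.proj β.proj α.proj β.proj β.snd) := by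
    exact hom_chart (F₁ := EuclideanSpace ℝ (Fin n)) (E₁ := fun x : M => TangentSpace (𝓡 n) x)
      (F₂ := ℝ) (E₂ := Bundle.Trivial M ℝ) α β
  simp only [extendCovector, momentum]
  rw [h, coordField_chartAt hβ]
  simp [evalSnd, ContinuousLinearMap.inCoordinates]
  rfl

variable {α : CotangentBundle n M}

/-- The two components of a tangent vector of the cotangent bundle in the preferred chart. -/
def tfst (ξ : TangentSpace (cotangentI n) α) : TangentSpace (𝓡 n) α.proj :=
  (show EuclideanSpace ℝ (Fin n) × CotangentModel n from ξ).1

/-- The covector component of a tangent vector in the preferred chart. -/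
def tsnd (ξ : TangentSpace (cotangentI n) α) : CotangentModel n :=
  (show EuclideanSpace ℝ (Fin n) × CotangentModel n from ξ).2

/-- The tangent vector with given components in the preferred chart. -/
def tmk (α : CotangentBundle n M) (v : TangentSpace (𝓡 n) α.proj) (p : CotangentModel n) :
    TangentSpace (cotangentI n) α :=
  (show EuclideanSpace ℝ (Fin n) × CotangentModel n from (v, p))

theorem mvfderiv_extendCovector_eq (ℓ : EuclideanSpace ℝ (Fin n) × CotangentModel n →L[ℝ] ℝ)
    (ξ : TangentSpace (cotangentI n) α) :
    mvfderiv (cotangentI n) (extendCovector (cotangentI n) α ℓ) α ξ =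
      ℓ (show EuclideanSpace ℝ (Fin n) × CotangentModel n from ξ) :=
  congrArg (fun L => L ξ) (mvfderiv_extendCovector_self (I := cotangentI n) α ℓ)

theorem dproj_apply (ξ : TangentSpace (cotangentI n) α) : dproj α ξ = tfst ξ := by
  have h : ∀ ℓ : EuclideanSpace ℝ (Fin n) →L[ℝ] ℝ, ℓ (dproj α ξ) = ℓ (tfst ξ) := fun ℓ => by
    have h1 := mvfderiv_extendCovector_eq
      (ℓ.comp (ContinuousLinearMap.fst ℝ _ (CotangentModel n))) ξ
    have h2 : ContMDiffAt (𝓡 n) 𝓘(ℝ, ℝ) ∞ (extendCovector (𝓡 n) α.proj ℓ) α.proj :=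
      contMDiffAt_extendCovector _ _ (mem_chart_source _ _)
    have h3 := congrArg (fun L => L ξ) (mvfderiv_comp_projection (α := α) h2.mdiff)
    have h4 := congrArg (fun L => L (dproj α ξ))
      (mvfderiv_extendCovector_self (I := 𝓡 n) α.proj ℓ)
    exact h4.symm.trans (h3.symm.trans h1)
  refine PiLp.ext (x := (show EuclideanSpace ℝ (Fin n) from dproj α ξ)) fun i => ?_
  exact h (EuclideanSpace.proj i)

/-- The momentum of the coordinate fields of the preferred chart. -/
theorem contMDiffAt_momentum_chartAt {β : CotangentBundle n M}
    (hβ : β.proj ∈ (chartAt (EuclideanSpace ℝ (Fin n)) α.proj).source) (i : Fin n) :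
    ContMDiffAt (cotangentI n) 𝓘(ℝ, ℝ) ∞
      (momentum (coordField (chartAt (EuclideanSpace ℝ (Fin n)) α.proj) i)) β := by
  refine (contMDiffAt_extendCovector (I := cotangentI n) α
    (evalSnd (EuclideanSpace.single i (1 : ℝ))) (cotangent_mem_chart_source hβ)).congr_of_eventuallyEq ?_
  filter_upwards [eventually_projection
    ((chartAt (EuclideanSpace ℝ (Fin n)) α.proj).open_source.mem_nhds hβ)] with y hy
  exact (extendCovector_evalSnd hy i).symm

theorem mvfderiv_momentum_chartAt (i : Fin n) (ξ : TangentSpace (cotangentI n) α) :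
    mvfderiv (cotangentI n) (momentum (coordField (chartAt (EuclideanSpace ℝ (Fin n)) α.proj) i)) α ξ
      = tsnd ξ (EuclideanSpace.single i (1 : ℝ)) := by
  have h : momentum (coordField (chartAt (EuclideanSpace ℝ (Fin n)) α.proj) i) =ᶠ[𝓝 α]
      extendCovector (cotangentI n) α (evalSnd (EuclideanSpace.single i (1 : ℝ))) := by
    filter_upwards [eventually_projection
      (chart_source_mem_nhds (EuclideanSpace ℝ (Fin n)) α.proj)] with y hy
    exact (extendCovector_evalSnd hy i).symm
  rw [mvfderiv_congr h]
  exact mvfderiv_extendCovector_eq (evalSnd (EuclideanSpace.single i (1 : ℝ))) ξ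

omit [IsManifold (𝓡 n) ∞ M] in
theorem momentum_eq_sum {e : OpenPartialHomeomorph M (EuclideanSpace ℝ (Fin n))}
    (he : IsSmoothChart M e) (hα : α.proj ∈ e.source) (Y : ∀ x : M, TangentSpace (𝓡 n) x) :
    momentum Y α = ∑ i, mvfderiv (𝓡 n) (coordFun e i) α.proj (Y α.proj) *
      momentum (coordField e i) α := by
  simp only [momentum]
  conv_lhs => rw [he.eq_sum_coordField hα (Y α.proj)]
  simp

theorem SmoothSectionAt.mvfderiv_coordFun {x : M}
    {e : OpenPartialHomeomorph M (EuclideanSpace ℝ (Fin n))}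
    (he : IsSmoothChart M e) (hx : x ∈ e.source) {Y : ∀ x : M, TangentSpace (𝓡 n) x}
    (hY : SmoothSectionAt n Y x) (i : Fin n) :
    ContMDiffAt (𝓡 n) 𝓘(ℝ, ℝ) ∞ (fun y => mvfderiv (𝓡 n) (coordFun e i) y (Y y)) x :=
  hY.smoothFieldAt _ (he.coordFun_contMDiffAt hx i)

theorem SmoothSectionAt.momentum {Y : ∀ x : M, TangentSpace (𝓡 n) x}
    (hY : SmoothSectionAt n Y α.proj) :
    ContMDiffAt (cotangentI n) 𝓘(ℝ, ℝ) ∞ (PoissonLift.momentum Y) α := by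
  have he := IsSmoothChart.chartAt (n := n) α.proj
  have hx := mem_chart_source (EuclideanSpace ℝ (Fin n)) α.proj
  refine ContMDiffAt.congr_of_eventuallyEq (ContMDiffAt.sum (t := Finset.univ) fun i _ =>
    (ContMDiffAt.comp_projection (hY.mvfderiv_coordFun he hx i)).mul
      (contMDiffAt_momentum_chartAt hx i)) ?_
  filter_upwards [eventually_projection
    ((chartAt (EuclideanSpace ℝ (Fin n)) α.proj).open_source.mem_nhds hx)] with y hy
  exact momentum_eq_sum he hy Y

/-- The differential of a momentum in terms of a chart. -/
theorem mvfderiv_momentum {e : OpenPartialHomeomorph M (EuclideanSpace ℝ (Fin n))}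
    (he : IsSmoothChart M e) (hα : α.proj ∈ e.source) {Y : ∀ x : M, TangentSpace (𝓡 n) x}
    (hY : SmoothSectionAt n Y α.proj) :
    mvfderiv (cotangentI n) (momentum Y) α = ∑ i,
      (mvfderiv (𝓡 n) (coordFun e i) α.proj (Y α.proj) •
        mvfderiv (cotangentI n) (momentum (coordField e i)) α +
      momentum (coordField e i) α •
        (mvfderiv (𝓡 n) (fun y => mvfderiv (𝓡 n) (coordFun e i) y (Y y)) α.proj).comp (dproj α)) := by
  have h := hY.mvfderiv_coordFun he hα
  rw [mvfderiv_congr (g := fun β : CotangentBundle n M =>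
    ∑ i, mvfderiv (𝓡 n) (coordFun e i) β.proj (Y β.proj) * momentum (coordField e i) β) ?_]
  · rw [mvfderiv_sum_mul _ (f := fun i (β : CotangentBundle n M) =>
      mvfderiv (𝓡 n) (coordFun e i) β.proj (Y β.proj)) (fun i _ => (h i).comp_projection.mdiff)
      (fun i _ => (he.coordField_smooth hα i).momentum.mdiff)]
    refine Finset.sum_congr rfl fun i _ => ?_
    rw [mvfderiv_comp_projection (h i).mdiff]
  · filter_upwards [eventually_projection (e.open_source.mem_nhds hα)] with y hy
    exact momentum_eq_sum he hy Y

/-- `dλ` in the preferred chart. -/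
theorem canonicalForm_apply (ξ η : TangentSpace (cotangentI n) α) :
    canonicalForm n M α ξ η = tsnd ξ (tfst η) - tsnd η (tfst ξ) := by
  have he := IsSmoothChart.chartAt (n := n) α.proj
  have : IsManifold (cotangentI n) 1 (CotangentBundle n M) := .of_le (n := ∞) (by simp)
  have key : ∀ ξ η : TangentSpace (cotangentI n) α,
      mvfderiv (cotangentI n) (fun y => liouville n M y
        (FiberBundle.extend (EuclideanSpace ℝ (Fin n) × CotangentModel n) η y)) α ξ =
      tsnd ξ (tfst η) := fun ξ η => by
    -- The extension of `η` has constant components in the chart, so λ evaluated on it is Σ η^i p_i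
    -- with constant η^i.
    have h1 : (fun y => liouville n M y
        (FiberBundle.extend (EuclideanSpace ℝ (Fin n) × CotangentModel n) η y)) =ᶠ[𝓝 α]
        fun y => ∑ i, (show EuclideanSpace ℝ (Fin n) from tfst η) i *
          momentum (coordField (chartAt (EuclideanSpace ℝ (Fin n)) α.proj) i) y := by
      filter_upwards [eventually_projection (chart_source_mem_nhds (EuclideanSpace ℝ (Fin n)) α.proj)] with y hy
      simp only [liouville, ContinuousLinearMap.comp_apply, momentum]
      conv_lhs => rw [he.eq_sum_coordField hy (dproj y _)]
      simp only [map_sum, map_smul, smul_eq_mul]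
      refine Finset.sum_congr rfl fun i _ => ?_
      congr 1
      have h2 : ContMDiffAt (𝓡 n) 𝓘(ℝ, ℝ) ∞ (extendCovector (𝓡 n) α.proj
          (EuclideanSpace.proj (𝕜 := ℝ) i)) y.proj := contMDiffAt_extendCovector _ _ hy
      have h3 := congrArg (fun L => L (FiberBundle.extend
        (EuclideanSpace ℝ (Fin n) × CotangentModel n) η y))
        (mvfderiv_comp_projection (α := y) h2.mdiff)
      refine h3.symm.trans ?_
      have h4 := mvfderiv_extendCovector (I := cotangentI n) α
        ((EuclideanSpace.proj (𝕜 := ℝ) i).comp (ContinuousLinearMap.fst ℝ _ (CotangentModel n)))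
        (cotangent_mem_chart_source hy) (FiberBundle.extend
        (EuclideanSpace ℝ (Fin n) × CotangentModel n) η y)
      refine h4.trans ?_
      rw [mvfderiv_extChartAt_extend (cotangent_mem_chart_source hy)]
      rfl
    rw [mvfderiv_congr h1, mvfderiv_sum_mul _ (fun i _ => mdifferentiableAt_const) (fun i _ =>
      (contMDiffAt_momentum_chartAt (mem_chart_source _ _) i).mdiff)]
    simp only [mvfderiv_const, smul_zero, add_zero, sum_apply, smul_apply, smul_eq_mul,
      mvfderiv_momentum_chartAt]
    have h5 : (show EuclideanSpace ℝ (Fin n) from tfst η) =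
      ∑ i, (show EuclideanSpace ℝ (Fin n) from tfst η) i • EuclideanSpace.single i (1 : ℝ) := by
      ext j
      simp [Pi.single_apply]
    refine Eq.trans ?_ (congrArg (tsnd ξ) h5).symm
    simp
  simp only [canonicalForm, extDerivOneForm]
  -- The bracket term of dλ vanishes because the two extensions commute.
  rw [key, key, mlieBracket_extend]
  simp

end Cotangent

/-! ### Canonical brackets of base functions and momenta. -/

section CanonicalBivector
open Filter Topology
variable {n : ℕ} {M : Type*} [TopologicalSpace M] [ChartedSpace (EuclideanSpace ℝ (Fin n)) M]
  [IsManifold (𝓡 n) ∞ M] {α : CotangentBundle n M}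

theorem eq_tmk_add_tmk (ξ : TangentSpace (cotangentI n) α) :
    ξ = tmk α (tfst ξ) 0 + tmk α 0 (tsnd ξ) := by
  refine Prod.ext (x := (show EuclideanSpace ℝ (Fin n) × CotangentModel n from ξ)) ?_ ?_
  · exact (add_zero (M := EuclideanSpace ℝ (Fin n)) _).symm
  · exact (zero_add (M := CotangentModel n) _).symm

theorem cotangentModel_eq_sum (p : CotangentModel n) : p = ∑ i, p (EuclideanSpace.single i (1 : ℝ)) •
    (EuclideanSpace.proj i : EuclideanSpace ℝ (Fin n) →L[ℝ] ℝ) := by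
  ext u
  have hu : u = ∑ i, u i • EuclideanSpace.single i (1 : ℝ) := by
    ext j
    simp [Pi.single_apply]
  conv_lhs => rw [hu]
  simp [mul_comm]

/-- Nondegeneracy of ω, by solving i_X ω = Φ explicitly in the Darboux form. -/
theorem sharpForm_canonicalForm (Φ : Covector (cotangentI n) α) (η : TangentSpace (cotangentI n) α) :
    canonicalForm n M α (sharpForm (cotangentI n) (canonicalForm n M) α Φ) η = Φ η := by
  refine Classical.epsilon_spec (p := fun X => ∀ Y : TangentSpace (cotangentI n) α,
    canonicalForm n M α X Y = Φ Y) ?_ η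
  let L : EuclideanSpace ℝ (Fin n) × CotangentModel n →L[ℝ] ℝ := Φ
  -- The fibre part of Φ is a linear form on covectors, hence evaluation at a vector `v`. The
  -- solution has base component `-v` and covector component the base part of Φ.
  let v : EuclideanSpace ℝ (Fin n) :=
    ∑ i, L (0, EuclideanSpace.proj i) • EuclideanSpace.single i (1 : ℝ)
  have hv : ∀ p : CotangentModel n, p v = L (0, p) := fun p => by
    have h0 : L (0, p) = (L.comp (ContinuousLinearMap.inr ℝ (EuclideanSpace ℝ (Fin n)) _)) p := by
      simp
    rw [h0]
    conv_rhs => rw [cotangentModel_eq_sum p]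
    simp [v, mul_comm]
  refine ⟨tmk α (-v : EuclideanSpace ℝ (Fin n))
    (L.comp (ContinuousLinearMap.inl ℝ _ (CotangentModel n))), fun η => ?_⟩
  rw [canonicalForm_apply]
  have h1 : L (show EuclideanSpace ℝ (Fin n) × CotangentModel n from η) =
    L (tfst η, 0) + L (0, tsnd η) := by
    rw [← map_add]
    congr 1
    exact eq_tmk_add_tmk η
  refine Eq.trans ?_ h1.symm
  rw [← hv]
  change L (tfst η, 0) - tsnd η (-v) = L (tfst η, 0) + tsnd η v
  rw [map_neg, sub_neg_eq_add]

theorem canonicalBivector_eq (Φ Ψ : Covector (cotangentI n) α) :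
    canonicalBivector n M α Φ Ψ = Φ (sharpForm (cotangentI n) (canonicalForm n M) α Ψ) :=
  sharpForm_canonicalForm _ _

theorem canonicalBivector_isAlternatingField :
    IsAlternatingField (canonicalBivector n M) where
  add_left z Φ Φ' Ψ := by simp [canonicalBivector_eq]
  smul_left z c Φ Ψ := by simp [canonicalBivector_eq]
  skew z Φ Ψ := by simp [canonicalBivector, canonicalForm_apply]

/-- Contraction of W₀ with a pulled-back covector is the vertical vector with components φ, up to
sign. All brackets with base functions follow from this. -/
theorem canonicalBivector_dproj (φ : Covector (𝓡 n) α.proj) (Ψ : Covector (cotangentI n) α) :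
    canonicalBivector n M α (φ.comp (dproj α)) Ψ = -Ψ (tmk α 0 φ) := by
  have h := sharpForm_canonicalForm Ψ (tmk α 0 φ)
  rw [canonicalBivector_eq, ← h, canonicalForm_apply, ContinuousLinearMap.comp_apply, dproj_apply]
  change _ = - (tsnd _ (0 : EuclideanSpace ℝ (Fin n)) - φ _)
  rw [map_zero, zero_sub, neg_neg]

theorem bracket_projection_left {f : M → ℝ}
    (hf : MDifferentiableAt (𝓡 n) 𝓘(ℝ, ℝ) f α.proj) (G : CotangentBundle n M → ℝ) :
    bracket (cotangentI n) (canonicalBivector n M) (fun β => f β.proj) G α =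
      - mvfderiv (cotangentI n) G α (tmk α 0 (mvfderiv (𝓡 n) f α.proj)) := by
  rw [bracket, mvfderiv_comp_projection hf, canonicalBivector_dproj]

theorem bracket_projection_projection {f g : M → ℝ}
    (hf : MDifferentiableAt (𝓡 n) 𝓘(ℝ, ℝ) f α.proj)
    (hg : MDifferentiableAt (𝓡 n) 𝓘(ℝ, ℝ) g α.proj) :
    bracket (cotangentI n) (canonicalBivector n M) (fun β => f β.proj) (fun β => g β.proj) α = 0 := by
  rw [bracket_projection_left hf, mvfderiv_comp_projection hg, ContinuousLinearMap.comp_apply,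
    dproj_apply]
  change - (mvfderiv (𝓡 n) g α.proj) 0 = 0
  rw [map_zero, neg_zero]

/-- The bracket with a base function differentiates in the vertical direction df; of d(m(Y)) = Y^i
dp_i + p_i dY^i only the first part survives there. -/
theorem bracket_momentum_projection {f : M → ℝ} {Y : ∀ x : M, TangentSpace (𝓡 n) x}
    (hY : SmoothSectionAt n Y α.proj)
    (hf : MDifferentiableAt (𝓡 n) 𝓘(ℝ, ℝ) f α.proj) :
    bracket (cotangentI n) (canonicalBivector n M) (momentum Y) (fun β => f β.proj) α =
      mvfderiv (𝓡 n) f α.proj (Y α.proj) := by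
  have he := IsSmoothChart.chartAt (n := n) α.proj
  have hx := mem_chart_source (EuclideanSpace ℝ (Fin n)) α.proj
  rw [canonicalBivector_isAlternatingField.bracket_skew, bracket_projection_left hf, neg_neg,
    mvfderiv_momentum he hx hY]
  conv_rhs => rw [he.eq_sum_coordField hx (Y α.proj)]
  simp only [sum_apply, add_apply, smul_apply, ContinuousLinearMap.comp_apply, dproj_apply, map_sum,
    map_smul, mvfderiv_momentum_chartAt]
  refine Finset.sum_congr rfl fun i _ => ?_
  have h1 : coordField (chartAt (EuclideanSpace ℝ (Fin n)) α.proj) i α.proj =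
      (show TangentSpace (𝓡 n) α.proj from EuclideanSpace.single i (1 : ℝ)) := by
    have h2 := he.mvfderiv_coordField hx i
    have h3 := mvfderiv_extChartAt_self α.proj
      (coordField (chartAt (EuclideanSpace ℝ (Fin n)) α.proj) i α.proj)
    exact h3.symm.trans h2
  rw [h1]
  change _ • (mvfderiv (𝓡 n) f α.proj) (EuclideanSpace.single i (1 : ℝ)) +
    _ • (mvfderiv (𝓡 n) _ α.proj) 0 = _
  rw [map_zero, smul_zero, add_zero]

/-- Obtained only at the centre α of the chart, where the splitting of tangent vectors into `tfst`
and `tsnd` is the coordinate splitting. Other points and charts are covered by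
`bracket_momentum_coordField`. -/
theorem bracket_momentum_chartAt (i j : Fin n) :
    bracket (cotangentI n) (canonicalBivector n M)
      (momentum (coordField (chartAt (EuclideanSpace ℝ (Fin n)) α.proj) i))
      (momentum (coordField (chartAt (EuclideanSpace ℝ (Fin n)) α.proj) j)) α = 0 := by
  set Ψ := mvfderiv (cotangentI n)
    (momentum (coordField (chartAt (EuclideanSpace ℝ (Fin n)) α.proj) j)) α with hΨ
  have h := sharpForm_canonicalForm Ψ
    (tmk α (EuclideanSpace.single i (1 : ℝ) : EuclideanSpace ℝ (Fin n)) 0)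
  rw [bracket, canonicalBivector_eq, mvfderiv_momentum_chartAt]
  rw [canonicalForm_apply, hΨ, mvfderiv_momentum_chartAt] at h
  exact (sub_zero _).symm.trans h

/-- The canonical bracket of momenta, in terms of the preferred chart. -/
theorem bracket_momentum_momentum {X Y : ∀ x : M, TangentSpace (𝓡 n) x}
    (hX : SmoothSectionAt n X α.proj) (hY : SmoothSectionAt n Y α.proj) :
    bracket (cotangentI n) (canonicalBivector n M) (momentum X) (momentum Y) α =
      ∑ i, momentum (coordField (chartAt (EuclideanSpace ℝ (Fin n)) α.proj) i) α *
        (mvfderiv (𝓡 n) (fun y => mvfderiv (𝓡 n)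
          (coordFun (chartAt (EuclideanSpace ℝ (Fin n)) α.proj) i) y (Y y)) α.proj (X α.proj) -
         mvfderiv (𝓡 n) (fun y => mvfderiv (𝓡 n)
          (coordFun (chartAt (EuclideanSpace ℝ (Fin n)) α.proj) i) y (X y)) α.proj (Y α.proj)) := by
  have he := IsSmoothChart.chartAt (n := n) α.proj
  have hx := mem_chart_source (EuclideanSpace ℝ (Fin n)) α.proj
  have hW := canonicalBivector_isAlternatingField (n := n) (M := M)
  set e := chartAt (EuclideanSpace ℝ (Fin n)) α.proj with hedef
  have hXi := fun i => (hX.mvfderiv_coordFun he hx i).mdiff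
  have hYi := fun i => (hY.mvfderiv_coordFun he hx i).mdiff
  have hZ := fun i => he.coordField_smooth hx i
  have hpf : ∀ (i : Fin n) {f : M → ℝ}, MDifferentiableAt (𝓡 n) 𝓘(ℝ, ℝ) f α.proj →
      canonicalBivector n M α (mvfderiv (cotangentI n) (momentum (coordField e i)) α)
        ((mvfderiv (𝓡 n) f α.proj).comp (dproj α)) =
        mvfderiv (𝓡 n) f α.proj (coordField e i α.proj) := fun i f hf => by
    rw [← bracket_momentum_projection (hZ i) hf, bracket, mvfderiv_comp_projection hf]
  have hfp : ∀ (i : Fin n) {f : M → ℝ}, MDifferentiableAt (𝓡 n) 𝓘(ℝ, ℝ) f α.proj →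
      canonicalBivector n M α ((mvfderiv (𝓡 n) f α.proj).comp (dproj α))
        (mvfderiv (cotangentI n) (momentum (coordField e i)) α) =
        - mvfderiv (𝓡 n) f α.proj (coordField e i α.proj) := fun i f hf => by
    rw [hW.skew, hpf i hf]
  have hff : ∀ {f g : M → ℝ}, MDifferentiableAt (𝓡 n) 𝓘(ℝ, ℝ) f α.proj →
      MDifferentiableAt (𝓡 n) 𝓘(ℝ, ℝ) g α.proj →
      canonicalBivector n M α ((mvfderiv (𝓡 n) f α.proj).comp (dproj α))
        ((mvfderiv (𝓡 n) g α.proj).comp (dproj α)) = 0 := fun {f g} hf hg => by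
    rw [← bracket_projection_projection hf hg, bracket, mvfderiv_comp_projection hf,
      mvfderiv_comp_projection hg]
  have hpp : ∀ i j, canonicalBivector n M α (mvfderiv (cotangentI n) (momentum (coordField e i)) α)
      (mvfderiv (cotangentI n) (momentum (coordField e j)) α) = 0 := bracket_momentum_chartAt
  -- Both differentials are expanded as Y^i dp_i + p_i dY^i. Only the mixed pairings survive, and
  -- they assemble to the components of [X, Y], so the result is m([X, Y]).
  rw [bracket, mvfderiv_momentum he hx hX, mvfderiv_momentum he hx hY]
  simp only [hW.sum_left, hW.sum_right, hW.add_left, hW.add_right, hW.smul_left, hW.smul_right, hpp,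
    hpf _ (hYi _), hfp _ (hXi _), hff (hXi _) (hYi _)]
  have hXe : ∀ φ : Covector (𝓡 n) α.proj, φ (X α.proj) =
      ∑ i, mvfderiv (𝓡 n) (coordFun e i) α.proj (X α.proj) * φ (coordField e i α.proj) := fun φ => by
    conv_lhs => rw [he.eq_sum_coordField hx (X α.proj)]
    simp
  have hYe : ∀ φ : Covector (𝓡 n) α.proj, φ (Y α.proj) =
      ∑ i, mvfderiv (𝓡 n) (coordFun e i) α.proj (Y α.proj) * φ (coordField e i α.proj) := fun φ => by
    conv_lhs => rw [he.eq_sum_coordField hx (Y α.proj)]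
    simp
  simp only [mul_zero, add_zero, zero_add]
  simp only [mul_sub, Finset.sum_sub_distrib]
  conv_rhs =>
    rw [Finset.sum_congr rfl fun i _ => by rw [hXe]]
    arg 2
    rw [Finset.sum_congr rfl fun i _ => by rw [hYe]]
  simp only [Finset.mul_sum, Finset.sum_add_distrib]
  rw [Finset.sum_comm, sub_eq_add_neg, ← Finset.sum_neg_distrib]
  congr 1
  · exact Finset.sum_congr rfl fun i _ => Finset.sum_congr rfl fun j _ => by ring
  · simp only [← Finset.sum_neg_distrib]
    exact Finset.sum_congr rfl fun i _ => Finset.sum_congr rfl fun j _ => by ring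

/-- The preferred chart at α serves as a frame, and the fields of the arbitrary chart `e` commute
when applied to its coordinate functions. -/
theorem bracket_momentum_coordField {e : OpenPartialHomeomorph M (EuclideanSpace ℝ (Fin n))}
    (he : IsSmoothChart M e) (hα : α.proj ∈ e.source) (i j : Fin n) :
    bracket (cotangentI n) (canonicalBivector n M) (momentum (coordField e i))
      (momentum (coordField e j)) α = 0 := by
  rw [bracket_momentum_momentum (he.coordField_smooth hα i) (he.coordField_smooth hα j)]
  refine Finset.sum_eq_zero fun k _ => ?_
  rw [he.mvfderiv_coordField_comm hα ((IsSmoothChart.chartAt α.proj).coordFun_contMDiffAt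
    (mem_chart_source _ _) k), sub_self, mul_zero]

/-- The restriction of a linear form on the model space to the base directions. -/
noncomputable def restrictFst (ℓ : EuclideanSpace ℝ (Fin n) × CotangentModel n →L[ℝ] ℝ) :
    EuclideanSpace ℝ (Fin n) →L[ℝ] ℝ :=
  ℓ.comp (ContinuousLinearMap.inl ℝ (EuclideanSpace ℝ (Fin n)) (CotangentModel n))

theorem model_form_eq_sum (ℓ : EuclideanSpace ℝ (Fin n) × CotangentModel n →L[ℝ] ℝ) :
    ℓ = (restrictFst ℓ).comp (ContinuousLinearMap.fst ℝ _ (CotangentModel n)) +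
      ∑ i, ℓ (0, EuclideanSpace.proj i) • evalSnd (EuclideanSpace.single i (1 : ℝ)) := by
  refine ContinuousLinearMap.ext fun u => ?_
  obtain ⟨v, p⟩ := u
  have h1 : ℓ (v, p) = ℓ (v, 0) + ℓ (0, p) := by simp [← map_add]
  have h2 : ℓ (0, p) = (ℓ.comp (ContinuousLinearMap.inr ℝ (EuclideanSpace ℝ (Fin n)) _)) p := by
    simp
  rw [h1, h2]
  conv_lhs => rw [cotangentModel_eq_sum p]
  simp [restrictFst, evalSnd, mul_comm]

/-- A covector of the cotangent bundle extended by the chart is a sum of a function on the base and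
of momenta. -/
theorem extendCovector_eq_sum (ℓ : EuclideanSpace ℝ (Fin n) × CotangentModel n →L[ℝ] ℝ)
    {β : CotangentBundle n M}
    (hβ : β.proj ∈ (chartAt (EuclideanSpace ℝ (Fin n)) α.proj).source) :
    extendCovector (cotangentI n) α ℓ β =
      extendCovector (𝓡 n) α.proj (restrictFst ℓ) β.proj +
      ∑ i, ℓ (0, EuclideanSpace.proj i) *
        momentum (coordField (chartAt (EuclideanSpace ℝ (Fin n)) α.proj) i) β := by
  simp only [← extendCovector_evalSnd hβ]
  refine (congrArg (fun L => L (extChartAt (cotangentI n) α β)) (model_form_eq_sum ℓ)).trans ?_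
  simp only [add_apply, sum_apply, smul_apply, smul_eq_mul]
  rfl

theorem mvfderiv_extendCovector_eq_sum
    (ℓ : EuclideanSpace ℝ (Fin n) × CotangentModel n →L[ℝ] ℝ) {β : CotangentBundle n M}
    (hβ : β.proj ∈ (chartAt (EuclideanSpace ℝ (Fin n)) α.proj).source) :
    mvfderiv (cotangentI n) (extendCovector (cotangentI n) α ℓ) β =
      (mvfderiv (𝓡 n) (extendCovector (𝓡 n) α.proj (restrictFst ℓ)) β.proj).comp (dproj β) +
      ∑ i, ℓ (0, EuclideanSpace.proj i) • mvfderiv (cotangentI n)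
        (momentum (coordField (chartAt (EuclideanSpace ℝ (Fin n)) α.proj) i)) β := by
  have h1 : ContMDiffAt (𝓡 n) 𝓘(ℝ, ℝ) ∞ (extendCovector (𝓡 n) α.proj (restrictFst ℓ)) β.proj :=
    contMDiffAt_extendCovector _ _ hβ
  have h2 : ∀ i, MDifferentiableAt (cotangentI n) 𝓘(ℝ, ℝ)
      (momentum (coordField (chartAt (EuclideanSpace ℝ (Fin n)) α.proj) i)) β := fun i =>
    (contMDiffAt_momentum_chartAt hβ i).mdiff
  have h3 : MDifferentiableAt (cotangentI n) 𝓘(ℝ, ℝ) (fun β => ∑ i, ℓ (0, EuclideanSpace.proj i) *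
        momentum (coordField (chartAt (EuclideanSpace ℝ (Fin n)) α.proj) i) β) β :=
    (mvfderiv_sum_apply _ fun i _ => mdifferentiableAt_const.mul (h2 i)).1
  have h4 : extendCovector (cotangentI n) α ℓ =ᶠ[𝓝 β] fun β =>
      extendCovector (𝓡 n) α.proj (restrictFst ℓ) β.proj +
      ∑ i, ℓ (0, EuclideanSpace.proj i) *
        momentum (coordField (chartAt (EuclideanSpace ℝ (Fin n)) α.proj) i) β := by
    filter_upwards [eventually_projection
      ((chartAt (EuclideanSpace ℝ (Fin n)) α.proj).open_source.mem_nhds hβ)] with y hy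
    exact extendCovector_eq_sum ℓ hy
  rw [mvfderiv_congr h4, mvfderiv_fun_add h1.comp_projection.mdiff h3,
    mvfderiv_comp_projection h1.mdiff,
    mvfderiv_sum_mul _ (fun i _ => mdifferentiableAt_const) (fun i _ => h2 i)]
  simp [mvfderiv_const]

/-- Chart-linear functions are a base function plus a constant combination of the p_i, so their
brackets are combinations of base derivatives ∂_i f. The chart stays fixed at α while β varies, so
{p_i, p_j} = 0 is needed away from the centre. -/
theorem canonicalBivector_smooth (α : CotangentBundle n M) :
    SmoothBiFieldAt (cotangentI n) (canonicalBivector n M) α := by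
  have hW := canonicalBivector_isAlternatingField (n := n) (M := M)
  refine smoothBiFieldAt_of_coordinates hW fun ℓ ℓ' => ?_
  have he := IsSmoothChart.chartAt (n := n) α.proj
  have hx := mem_chart_source (EuclideanSpace ℝ (Fin n)) α.proj
  set e := chartAt (EuclideanSpace ℝ (Fin n)) α.proj with hedef
  have hs : ∀ (ℓ : EuclideanSpace ℝ (Fin n) →L[ℝ] ℝ) {y : M}, y ∈ e.source →
      ContMDiffAt (𝓡 n) 𝓘(ℝ, ℝ) ∞ (extendCovector (𝓡 n) α.proj ℓ) y := fun ℓ y hy =>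
    contMDiffAt_extendCovector _ _ hy
  have hsum : ∀ ℓ ℓ' : EuclideanSpace ℝ (Fin n) × CotangentModel n →L[ℝ] ℝ,
      ContMDiffAt (cotangentI n) 𝓘(ℝ, ℝ) ∞ (fun β : CotangentBundle n M =>
        ∑ i, ℓ (0, EuclideanSpace.proj i) * mvfderiv (𝓡 n)
          (extendCovector (𝓡 n) α.proj (restrictFst ℓ')) β.proj (coordField e i β.proj)) α :=
    fun ℓ ℓ' => ContMDiffAt.sum (t := Finset.univ) fun i _ => contMDiffAt_const.mul
      ((he.coordField_smooth hx i).smoothFieldAt _ (hs _ hx)).comp_projection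
  refine ((hsum ℓ ℓ').sub (hsum ℓ' ℓ)).congr_of_eventuallyEq ?_
  filter_upwards [eventually_projection (e.open_source.mem_nhds hx)] with β hβ
  have hpf : ∀ (i : Fin n) (ℓ : EuclideanSpace ℝ (Fin n) →L[ℝ] ℝ),
      canonicalBivector n M β (mvfderiv (cotangentI n) (momentum (coordField e i)) β)
        ((mvfderiv (𝓡 n) (extendCovector (𝓡 n) α.proj ℓ) β.proj).comp (dproj β)) =
        mvfderiv (𝓡 n) (extendCovector (𝓡 n) α.proj ℓ) β.proj (coordField e i β.proj) :=
    fun i ℓ => by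
      rw [← bracket_momentum_projection (he.coordField_smooth hβ i) (hs ℓ hβ).mdiff, bracket,
        mvfderiv_comp_projection (hs ℓ hβ).mdiff]
  have hff : ∀ ℓ ℓ' : EuclideanSpace ℝ (Fin n) →L[ℝ] ℝ,
      canonicalBivector n M β
        ((mvfderiv (𝓡 n) (extendCovector (𝓡 n) α.proj ℓ) β.proj).comp (dproj β))
        ((mvfderiv (𝓡 n) (extendCovector (𝓡 n) α.proj ℓ') β.proj).comp (dproj β)) = 0 :=
    fun ℓ ℓ' => by
      rw [← bracket_projection_projection (hs ℓ hβ).mdiff (hs ℓ' hβ).mdiff, bracket,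
        mvfderiv_comp_projection (hs ℓ hβ).mdiff, mvfderiv_comp_projection (hs ℓ' hβ).mdiff]
  have hpp : ∀ i j, canonicalBivector n M β (mvfderiv (cotangentI n) (momentum (coordField e i)) β)
      (mvfderiv (cotangentI n) (momentum (coordField e j)) β) = 0 :=
    bracket_momentum_coordField he hβ
  rw [bracket, mvfderiv_extendCovector_eq_sum ℓ hβ, mvfderiv_extendCovector_eq_sum ℓ' hβ]
  simp only [hW.sum_left, hW.sum_right, hW.add_left, hW.add_right, hW.smul_left, hW.smul_right,
    ← hedef, hpp, hff, hpf, mul_zero, Finset.sum_const_zero, add_zero, zero_add,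
    hW.skew β (ContinuousLinearMap.comp _ _) (mvfderiv (cotangentI n) (momentum _) β)]
  simp only [mul_neg, Finset.sum_neg_distrib]
  ring

end CanonicalBivector

/-! ### Horizontal lifts and the action of K on base functions and momenta. -/

section HorizontalLift
open Filter Topology
variable {n : ℕ} {M : Type*} [TopologicalSpace M] [ChartedSpace (EuclideanSpace ℝ (Fin n)) M]
  [IsManifold (𝓡 n) ∞ M] {α : CotangentBundle n M}
  (cov : CovariantDerivative (𝓡 n) (EuclideanSpace ℝ (Fin n)) (TangentSpace (𝓡 n) : M → Type _))

theorem cov_sum {ι : Type*} (s : Finset ι) {x : M} {g : ι → M → ℝ}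
    {Z : ι → ∀ x : M, TangentSpace (𝓡 n) x}
    (hg : ∀ i, ContMDiffAt (𝓡 n) 𝓘(ℝ, ℝ) ∞ (g i) x) (hZ : ∀ i, SmoothSectionAt n (Z i) x) :
    cov (fun y => ∑ i ∈ s, g i y • Z i y) x =
      ∑ i ∈ s, (g i x • cov (Z i) x + (mvfderiv (𝓡 n) (g i) x).smulRight (Z i x)) := by
  classical
  induction s using Finset.induction_on with
  | empty =>
    simp only [Finset.sum_empty]
    exact congrFun cov.zero x
  | insert i s hi ih =>
    simp only [Finset.sum_insert hi]
    have h1 := cov.isCovariantDerivativeOnUniv.add (x := x) (σ := g i • Z i)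
      (σ' := fun y => ∑ i ∈ s, g i y • Z i y) ((hZ i).smul (hg i)).mdiff
      (SmoothSectionAt.sum fun i _ => (hZ i).smul (hg i)).mdiff
    rw [ih, cov.isCovariantDerivativeOnUniv.leibniz (hZ i).mdiff (hg i).mdiff] at h1
    exact h1

/-- The connection in terms of a chart. -/
theorem cov_eq_sum {e : OpenPartialHomeomorph M (EuclideanSpace ℝ (Fin n))} {x : M}
    (he : IsSmoothChart M e) (hx : x ∈ e.source) {Y : ∀ x : M, TangentSpace (𝓡 n) x}
    (hY : SmoothSectionAt n Y x) :
    cov Y x = ∑ i, (mvfderiv (𝓡 n) (coordFun e i) x (Y x) • cov (coordField e i) x +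
      (mvfderiv (𝓡 n) (fun y => mvfderiv (𝓡 n) (coordFun e i) y (Y y)) x).smulRight
        (coordField e i x)) := by
  rw [← cov_sum cov _ (hY.mvfderiv_coordFun he hx) (he.coordField_smooth hx)]
  refine cov.isCovariantDerivativeOnUniv.congr_of_eventuallyEq hY.mdiff
    (SmoothSectionAt.sum fun i _ =>
      (he.coordField_smooth hx i).smul (hY.mvfderiv_coordFun he hx i)).mdiff univ_mem ?_
  filter_upwards [e.open_source.mem_nhds hx] with y hy
  exact he.eq_sum_coordField hy (Y y)

/-- Testing on coordinate fields dictates the covector components α(∇_X ∂_i). For general Y = Y^i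
∂_i, both sides obey the same Leibniz rule. -/
theorem isHorizontalLift_horizontalLift (X : TangentSpace (𝓡 n) α.proj) :
    IsHorizontalLift cov α X (horizontalLift cov α X) := by
  refine Classical.epsilon_spec (p := IsHorizontalLift cov α X) ?_
  have he := IsSmoothChart.chartAt (n := n) α.proj
  have hx := mem_chart_source (EuclideanSpace ℝ (Fin n)) α.proj
  set e := chartAt (EuclideanSpace ℝ (Fin n)) α.proj with hedef
  let η : CotangentModel n := ∑ i, α.snd (cov (coordField e i) α.proj X) •
    (EuclideanSpace.proj i : EuclideanSpace ℝ (Fin n) →L[ℝ] ℝ)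
  refine ⟨tmk α X η, dproj_apply _, fun Y hY => ?_⟩
  rw [mvfderiv_momentum he hx hY, cov_eq_sum cov he hx hY]
  simp only [sum_apply, add_apply, smul_apply, ContinuousLinearMap.comp_apply, dproj_apply, map_sum,
    map_add, map_smul, ContinuousLinearMap.smulRight_apply, hedef, mvfderiv_momentum_chartAt,
    smul_eq_mul]
  refine Finset.sum_congr rfl fun i _ => ?_
  have h1 : tsnd (tmk α X η) (EuclideanSpace.single i (1 : ℝ)) =
      α.snd (cov (coordField e i) α.proj X) := by
    change η (EuclideanSpace.single i (1 : ℝ)) = _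
    simp [η]
  rw [h1, mul_comm (momentum _ _)]
  rfl

variable {w : BiField (𝓡 n) M}

theorem mvfderiv_projection_fieldK (hw : IsAlternatingField w) {f : M → ℝ}
    (hf : MDifferentiableAt (𝓡 n) 𝓘(ℝ, ℝ) f α.proj) :
    mvfderiv (cotangentI n) (fun β : CotangentBundle n M => f β.proj) α (fieldK cov w α) =
      w α.proj α.snd (mvfderiv (𝓡 n) f α.proj) := by
  rw [mvfderiv_comp_projection hf, ContinuousLinearMap.comp_apply, fieldK,
    (isHorizontalLift_horizontalLift cov _).1, apply_sharp hw]

theorem mvfderiv_momentum_fieldK {Y : ∀ x : M, TangentSpace (𝓡 n) x}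
    (hY : SmoothSectionAt n Y α.proj) :
    mvfderiv (cotangentI n) (momentum Y) α (fieldK cov w α) =
      α.snd (cov Y α.proj (sharp (𝓡 n) w α.proj α.snd)) :=
  (isHorizontalLift_horizontalLift cov _).2 Y hY

variable {e : OpenPartialHomeomorph M (EuclideanSpace ℝ (Fin n))}

omit [IsManifold (𝓡 n) ∞ M] in
theorem IsSmoothChart.covector_eq_sum (he : IsSmoothChart M e) (hα : α.proj ∈ e.source) :
    α.snd = ∑ a, momentum (coordField e a) α • mvfderiv (𝓡 n) (coordFun e a) α.proj := by
  refine ContinuousLinearMap.ext fun v => ?_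
  conv_lhs => rw [he.eq_sum_coordField hα v]
  simp [momentum, mul_comm]

theorem mvfderiv_projection_fieldK_chart (hw : IsAlternatingField w) (he : IsSmoothChart M e)
    (hα : α.proj ∈ e.source) {f : M → ℝ} (hf : MDifferentiableAt (𝓡 n) 𝓘(ℝ, ℝ) f α.proj) :
    mvfderiv (cotangentI n) (fun β : CotangentBundle n M => f β.proj) α (fieldK cov w α) =
      ∑ a, momentum (coordField e a) α * bracket (𝓡 n) w (coordFun e a) f α.proj := by
  rw [mvfderiv_projection_fieldK cov hw hf]
  conv_lhs => rw [he.covector_eq_sum hα]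
  rw [hw.sum_left]
  simp only [hw.smul_left, bracket]

/-- The `b`-th component of `∇_X Y`, where `X` is the Hamiltonian field of the `a`-th coordinate
function. -/
noncomputable def hamiltonianCov (w : BiField (𝓡 n) M)
    (e : OpenPartialHomeomorph M (EuclideanSpace ℝ (Fin n)))
    (Y : ∀ x : M, TangentSpace (𝓡 n) x) (a b : Fin n) (x : M) : ℝ :=
  mvfderiv (𝓡 n) (coordFun e b) x
    (cov Y x (sharp (𝓡 n) w x (mvfderiv (𝓡 n) (coordFun e a) x)))

/-- The covector α enters α(∇_{♯_w α} Y) twice, through ♯_w and through the pairing, which makes the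
value quadratic in the momenta. -/
theorem mvfderiv_momentum_fieldK_chart (hw : IsAlternatingField w) (he : IsSmoothChart M e)
    (hα : α.proj ∈ e.source) {Y : ∀ x : M, TangentSpace (𝓡 n) x}
    (hY : SmoothSectionAt n Y α.proj) :
    mvfderiv (cotangentI n) (momentum Y) α (fieldK cov w α) =
      ∑ a, ∑ b, momentum (coordField e a) α * momentum (coordField e b) α *
        hamiltonianCov cov w e Y a b α.proj := by
  -- Written as w(α, α ∘ ∇Y), so that the two occurrences of α can be expanded one at a time.
  rw [mvfderiv_momentum_fieldK cov hY, ← ContinuousLinearMap.comp_apply, apply_sharp hw]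
  conv_lhs =>
    enter [2]
    rw [he.covector_eq_sum hα]
  rw [hw.sum_left]
  refine Finset.sum_congr rfl fun a _ => ?_
  rw [hw.smul_left, ← apply_sharp hw, ContinuousLinearMap.comp_apply]
  conv_lhs =>
    enter [2, 1]
    rw [he.covector_eq_sum hα]
  simp only [sum_apply, smul_apply, smul_eq_mul, Finset.mul_sum, hamiltonianCov, mul_assoc]

variable [T2Space M] [CovariantDerivative.ContMDiffCovariantDerivative cov ∞]

theorem IsSmoothChart.bracket_coordFun_smooth (hw : IsBivectorField (𝓡 n) w)
    (he : IsSmoothChart M e) {x : M} (hx : x ∈ e.source) (i : Fin n) {f : M → ℝ}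
    (hf : ∀ᶠ y in 𝓝 x, ContMDiffAt (𝓡 n) 𝓘(ℝ, ℝ) ∞ f y) :
    ContMDiffAt (𝓡 n) 𝓘(ℝ, ℝ) ∞ (bracket (𝓡 n) w (coordFun e i) f) x := by
  refine contMDiffAt_bracket_of_isBivectorField hw ?_ hf
  filter_upwards [e.open_source.mem_nhds hx] with y hy using he.coordFun_contMDiffAt hy i

theorem hamiltonianCov_smooth (hw : IsBivectorField (𝓡 n) w)
    (he : IsSmoothChart M e) {x : M} (hx : x ∈ e.source) {Y : ∀ x : M, TangentSpace (𝓡 n) x}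
    (hY : ∀ᶠ y in 𝓝 x, SmoothSectionAt n Y y) (a b : Fin n) :
    ContMDiffAt (𝓡 n) 𝓘(ℝ, ℝ) ∞ (hamiltonianCov cov w e Y a b) x := by
  refine (smoothSectionAt_cov cov (smoothSectionAt_sharp hw ?_) hY).mvfderiv_coordFun he hx b
  filter_upwards [e.open_source.mem_nhds hx] with y hy using he.coordFun_contMDiffAt hy a

/-- Applied to base functions and to the p_i, K gives polynomials in the momenta with smooth
coefficients on the base. -/
theorem fieldK_smooth (hw : IsBivectorField (𝓡 n) w) (α : CotangentBundle n M) :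
    SmoothFieldAt (cotangentI n) (fieldK cov w) α := by
  refine smoothFieldAt_of_coordinates fun ℓ => ?_
  have he := IsSmoothChart.chartAt (n := n) α.proj
  have hx := mem_chart_source (EuclideanSpace ℝ (Fin n)) α.proj
  set e := chartAt (EuclideanSpace ℝ (Fin n)) α.proj with hedef
  set f := extendCovector (𝓡 n) α.proj (restrictFst ℓ)
  have hs : ∀ {y : M}, y ∈ e.source → ContMDiffAt (𝓡 n) 𝓘(ℝ, ℝ) ∞ f y := fun hy =>
    contMDiffAt_extendCovector _ _ hy
  have hsrc := e.open_source.mem_nhds hx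
  have hp := fun i => (he.coordField_smooth hx i).momentum
  have h1 : ContMDiffAt (cotangentI n) 𝓘(ℝ, ℝ) ∞ (fun β : CotangentBundle n M =>
      ∑ a, momentum (coordField e a) β * bracket (𝓡 n) w (coordFun e a) f β.proj) α :=
    ContMDiffAt.sum (t := Finset.univ) fun a _ => (hp a).mul
      (he.bracket_coordFun_smooth hw hx a (by filter_upwards [hsrc] with y hy using hs hy)).comp_projection
  have h2 : ∀ i, ContMDiffAt (cotangentI n) 𝓘(ℝ, ℝ) ∞ (fun β : CotangentBundle n M =>
      ∑ a, ∑ b, momentum (coordField e a) β * momentum (coordField e b) β *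
        hamiltonianCov cov w e (coordField e i) a b β.proj) α := fun i =>
    ContMDiffAt.sum (t := Finset.univ) fun a _ => ContMDiffAt.sum (t := Finset.univ) fun b _ =>
      ((hp a).mul (hp b)).mul (hamiltonianCov_smooth cov hw he hx
        (by filter_upwards [hsrc] with y hy using he.coordField_smooth hy i) a b).comp_projection
  refine (h1.add (ContMDiffAt.sum (t := Finset.univ) fun i _ =>
    (contMDiffAt_const (c := ℓ (0, EuclideanSpace.proj i))).mul (h2 i))).congr_of_eventuallyEq ?_
  filter_upwards [eventually_projection hsrc] with β hβ
  rw [mvfderiv_extendCovector_eq_sum ℓ hβ]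
  simp only [add_apply, sum_apply, smul_apply, smul_eq_mul]
  rw [← mvfderiv_comp_projection (hs hβ).mdiff,
    mvfderiv_projection_fieldK_chart cov hw.isAlternatingField he hβ (hs hβ).mdiff]
  congr 1
  refine Finset.sum_congr rfl fun i _ => ?_
  rw [mvfderiv_momentum_fieldK_chart cov hw.isAlternatingField he hβ (he.coordField_smooth hβ i)]
  rfl

end HorizontalLift

/-! ### Brackets of the graded lift, and the three properties. -/

section GradedLift
open Filter Topology
variable {n : ℕ} {M : Type*} [TopologicalSpace M] [T2Space M]
  [ChartedSpace (EuclideanSpace ℝ (Fin n)) M] [IsManifold (𝓡 n) ∞ M] {α : CotangentBundle n M}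
  (cov : CovariantDerivative (𝓡 n) (EuclideanSpace ℝ (Fin n)) (TangentSpace (𝓡 n) : M → Type _))
  [CovariantDerivative.ContMDiffCovariantDerivative cov ∞]
  {w : BiField (𝓡 n) M} (hw : IsBivectorField (𝓡 n) w)

omit [T2Space M] [IsManifold (𝓡 n) ∞ M] in
theorem coordX_eq (e : OpenPartialHomeomorph M (EuclideanSpace ℝ (Fin n))) (i : Fin n) :
    (coordX e i : CotangentBundle n M → ℝ) = fun β => coordFun e i β.proj := rfl

omit [T2Space M] [IsManifold (𝓡 n) ∞ M] in
theorem coordP_eq (e : OpenPartialHomeomorph M (EuclideanSpace ℝ (Fin n))) (i : Fin n) :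
    (coordP e i : CotangentBundle n M → ℝ) = momentum (coordField e i) := rfl

include hw

/-- Tensoriality lets the Lie derivative formula be applied directly to pullbacks and momenta of an
arbitrary chart. -/
theorem bracket_gradedLift {F G : CotangentBundle n M → ℝ}
    (hF : ContMDiffAt (cotangentI n) 𝓘(ℝ, ℝ) ∞ F α)
    (hG : ContMDiffAt (cotangentI n) 𝓘(ℝ, ℝ) ∞ G α) :
    bracket (cotangentI n) (gradedLift cov w) F G α =
      (1 / 2 : ℝ) * lieExpr (cotangentI n) (fieldK cov w) (canonicalBivector n M) F G α := by
  rw [bracket, gradedLift, lieDerivative_mvfderiv canonicalBivector_isAlternatingField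
    (canonicalBivector_smooth α) (fieldK_smooth cov hw α) hF hG]

theorem gradedLift_isBivectorField : IsBivectorField (cotangentI n) (gradedLift cov w) := by
  have h := lieDerivative_isAlternatingField canonicalBivector_isAlternatingField
    canonicalBivector_smooth (fieldK_smooth cov hw)
  refine ⟨fun z Φ Φ' Ψ => ?_, fun z c Φ Ψ => ?_, fun z Φ Ψ => ?_, fun F G hF hG α => ?_⟩
  · simp only [gradedLift, h.add_left, mul_add]
  · simp only [gradedLift, h.smul_left]
    ring
  · simp only [gradedLift]
    rw [h.skew, mul_neg]
  · have h1 := lieExpr_contMDiffAt (canonicalBivector_smooth α) (fieldK_smooth cov hw α)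
      (hF α) (hG α)
    refine ((contMDiffAt_const (c := (1 / 2 : ℝ))).mul h1).congr_of_eventuallyEq
      (Eventually.of_forall fun β => ?_)
    rw [bracket_gradedLift cov hw (hF β) (hG β)]
    rfl

omit [T2Space M] [CovariantDerivative.ContMDiffCovariantDerivative cov ∞] in
theorem mvfderiv_projection_fieldK_eq_momentum {f : M → ℝ}
    (hf : ∀ᶠ y in 𝓝 α.proj, ContMDiffAt (𝓡 n) 𝓘(ℝ, ℝ) ∞ f y) :
    (fun β => mvfderiv (cotangentI n) (fun β : CotangentBundle n M => f β.proj) β (fieldK cov w β))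
      =ᶠ[𝓝 α]
    momentum fun y => (-1 : ℝ) • sharp (𝓡 n) w y (mvfderiv (𝓡 n) f y) := by
  filter_upwards [eventually_projection hf] with β hβ
  rw [mvfderiv_projection_fieldK cov hw.isAlternatingField hβ.mdiff, momentum, map_smul,
    apply_sharp hw.isAlternatingField, hw.skew]
  simp

omit [CovariantDerivative.ContMDiffCovariantDerivative cov ∞] in
theorem canonicalBivector_mvfderiv_fieldK {f g : M → ℝ}
    (hf : ∀ᶠ y in 𝓝 α.proj, ContMDiffAt (𝓡 n) 𝓘(ℝ, ℝ) ∞ f y)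
    (hg : MDifferentiableAt (𝓡 n) 𝓘(ℝ, ℝ) g α.proj) :
    canonicalBivector n M α (mvfderiv (cotangentI n) (fun β => mvfderiv (cotangentI n)
        (fun β : CotangentBundle n M => f β.proj) β (fieldK cov w β)) α)
      (mvfderiv (cotangentI n) (fun β : CotangentBundle n M => g β.proj) α) =
      -bracket (𝓡 n) w f g α.proj := by
  have hX : SmoothSectionAt n (fun y => (-1 : ℝ) • sharp (𝓡 n) w y (mvfderiv (𝓡 n) f y)) α.proj :=
    (smoothSectionAt_sharp hw hf).smul contMDiffAt_const
  rw [mvfderiv_congr (mvfderiv_projection_fieldK_eq_momentum cov hw hf)]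
  refine (bracket_momentum_projection hX hg).trans ?_
  rw [map_smul, apply_sharp hw.isAlternatingField]
  simp [bracket]

/-- {π^*f, π^*g} vanishes near α, so its K-derivative does too. The terms -{K f, g} and -{f, K g}
each equal {f, g}_w, and the factor ½ in W₂ compensates for their sum. -/
theorem bracket_gradedLift_projection {f g : M → ℝ}
    (hf : ∀ᶠ y in 𝓝 α.proj, ContMDiffAt (𝓡 n) 𝓘(ℝ, ℝ) ∞ f y)
    (hg : ∀ᶠ y in 𝓝 α.proj, ContMDiffAt (𝓡 n) 𝓘(ℝ, ℝ) ∞ g y) :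
    bracket (cotangentI n) (gradedLift cov w) (fun β => f β.proj) (fun β => g β.proj) α =
      bracket (𝓡 n) w f g α.proj := by
  have h0 : bracket (cotangentI n) (canonicalBivector n M) (fun β => f β.proj)
      (fun β => g β.proj) =ᶠ[𝓝 α] fun _ => 0 := by
    filter_upwards [eventually_projection hf, eventually_projection hg] with β h1 h2
    exact bracket_projection_projection h1.mdiff h2.mdiff
  rw [bracket_gradedLift cov hw hf.self_of_nhds.comp_projection hg.self_of_nhds.comp_projection,
    lieExpr, mvfderiv_congr h0, canonicalBivector_mvfderiv_fieldK cov hw hf hg.self_of_nhds.mdiff,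
    canonicalBivector_isAlternatingField.skew α (mvfderiv _ (fun β => f β.proj) α),
    canonicalBivector_mvfderiv_fieldK cov hw hg hf.self_of_nhds.mdiff,
    hw.isAlternatingField.bracket_skew g f, mvfderiv_const]
  simp
  ring

theorem gradedLift_isProjRelated : IsProjRelated (gradedLift cov w) w := by
  intro α φ ψ
  have hs : ∀ φ : Covector (𝓡 n) α.proj, ∀ᶠ y in 𝓝 α.proj,
      ContMDiffAt (𝓡 n) 𝓘(ℝ, ℝ) ∞ (extendCovector (𝓡 n) α.proj φ) y := fun φ => by
    filter_upwards [chart_source_mem_nhds (EuclideanSpace ℝ (Fin n)) α.proj] with y hy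
    exact contMDiffAt_extendCovector _ _ hy
  have h := bracket_gradedLift_projection cov hw (hs φ) (hs ψ)
  simp only [bracket, mvfderiv_extendCovector_self] at h
  rwa [mvfderiv_comp_projection (hs φ).self_of_nhds.mdiff,
    mvfderiv_comp_projection (hs ψ).self_of_nhds.mdiff, mvfderiv_extendCovector_self,
    mvfderiv_extendCovector_self] at h

-- The function on M is the restriction to the zero section, which is a smooth section of π.
omit hw [T2Space M] in
theorem PoissonLift.IsFoliated.exists_eq {F : CotangentBundle n M → ℝ} (hF : IsFoliated F) :
    ∃ f : M → ℝ, IsSmooth (𝓡 n) f ∧ F = fun β => f β.proj := by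
  refine ⟨fun x => F ⟨x, 0⟩, ?_, funext fun β => hF.const_on_fibres _ _ rfl⟩
  exact hF.smooth.comp (Bundle.contMDiff_zeroSection ℝ
    (fun x : M => TangentSpace (𝓡 n) x →L[ℝ] ℝ))

/-- On pullbacks the bracket is the pullback of {·,·}_w, so closure is smoothness of w and the
Jacobi identity is that of w. -/
theorem gradedLift_isSemiPoisson (hP : IsPoisson (𝓡 n) w) : IsSemiPoisson (gradedLift cov w) := by
  have hb : ∀ {f g : M → ℝ}, IsSmooth (𝓡 n) f → IsSmooth (𝓡 n) g →
      bracket (cotangentI n) (gradedLift cov w) (fun β => f β.proj) (fun β => g β.proj) =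
        fun β => bracket (𝓡 n) w f g β.proj := fun hf hg => funext fun β =>
    bracket_gradedLift_projection cov hw (Eventually.of_forall hf) (Eventually.of_forall hg)
  refine ⟨gradedLift_isBivectorField cov hw, fun F G hF hG => ?_, fun F G L hF hG hL α => ?_⟩
  · obtain ⟨f, hf, rfl⟩ := hF.exists_eq
    obtain ⟨g, hg, rfl⟩ := hG.exists_eq
    rw [hb hf hg]
    exact ⟨fun β => ((hw.smooth f g hf hg) _).comp_projection, fun α β h => by simp only [h]⟩
  · obtain ⟨f, hf, rfl⟩ := hF.exists_eq
    obtain ⟨g, hg, rfl⟩ := hG.exists_eq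
    obtain ⟨l, hl, rfl⟩ := hL.exists_eq
    rw [hb hf hg, hb hg hl, hb hl hf, hb hf (hw.smooth _ _ hg hl), hb hg (hw.smooth _ _ hl hf),
      hb hl (hw.smooth _ _ hf hg)]
    exact hP.jacobi f g l hf hg hl _

variable {e : OpenPartialHomeomorph M (EuclideanSpace ℝ (Fin n))}

-- In K(π^*f) = p_a {x^a, f}_w only the coefficients contribute, as {p_a, p_j} = 0; bracketing a
-- base function with p_j gives minus its ∂_j.
omit [CovariantDerivative.ContMDiffCovariantDerivative cov ∞] in
theorem canonicalBivector_fieldK_projection_momentum (he : IsSmoothChart M e)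
    (hα : α.proj ∈ e.source) {f : M → ℝ}
    (hf : ∀ᶠ y in 𝓝 α.proj, ContMDiffAt (𝓡 n) 𝓘(ℝ, ℝ) ∞ f y) (j : Fin n) :
    canonicalBivector n M α (mvfderiv (cotangentI n) (fun β => mvfderiv (cotangentI n)
        (fun β : CotangentBundle n M => f β.proj) β (fieldK cov w β)) α)
      (mvfderiv (cotangentI n) (momentum (coordField e j)) α) =
      -∑ a, momentum (coordField e a) α *
        mvfderiv (𝓡 n) (bracket (𝓡 n) w (coordFun e a) f) α.proj (coordField e j α.proj) := by
  have hW := canonicalBivector_isAlternatingField (n := n) (M := M)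
  have h1 : (fun β => mvfderiv (cotangentI n)
        (fun β : CotangentBundle n M => f β.proj) β (fieldK cov w β)) =ᶠ[𝓝 α] fun β =>
      ∑ a, momentum (coordField e a) β * bracket (𝓡 n) w (coordFun e a) f β.proj := by
    filter_upwards [eventually_projection hf,
      eventually_projection (e.open_source.mem_nhds hα)] with β h1 h2
    exact mvfderiv_projection_fieldK_chart cov hw.isAlternatingField he h2 h1.mdiff
  have h2 := fun a => he.bracket_coordFun_smooth hw hα a hf
  rw [mvfderiv_congr h1, mvfderiv_sum_mul _
    (g := fun a (β : CotangentBundle n M) => bracket (𝓡 n) w (coordFun e a) f β.proj)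
    (fun a _ => (he.coordField_smooth hα a).momentum.mdiff)
    (fun a _ => (h2 a).comp_projection.mdiff), hW.sum_left, ← Finset.sum_neg_distrib]
  refine Finset.sum_congr rfl fun a _ => ?_
  have h3 := bracket_momentum_coordField he hα a j
  have h4 := bracket_momentum_projection (he.coordField_smooth hα j) (h2 a).mdiff
  rw [bracket] at h3 h4
  rw [hW.add_left, hW.smul_left, hW.smul_left, h3, hW.skew, h4]
  ring

theorem mvfderiv_fieldK_momentum (he : IsSmoothChart M e) (hα : α.proj ∈ e.source)
    {Y : ∀ x : M, TangentSpace (𝓡 n) x} (hY : ∀ᶠ y in 𝓝 α.proj, SmoothSectionAt n Y y) :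
    mvfderiv (cotangentI n) (fun β => mvfderiv (cotangentI n) (momentum Y) β (fieldK cov w β)) α =
      ∑ a, ∑ b, (
        (momentum (coordField e b) α * hamiltonianCov cov w e Y a b α.proj) •
          mvfderiv (cotangentI n) (momentum (coordField e a)) α +
        (momentum (coordField e a) α * hamiltonianCov cov w e Y a b α.proj) •
          mvfderiv (cotangentI n) (momentum (coordField e b)) α +
        (momentum (coordField e a) α * momentum (coordField e b) α) •
          mvfderiv (cotangentI n) (fun β => hamiltonianCov cov w e Y a b β.proj) α) := by
  have h1 : (fun β => mvfderiv (cotangentI n) (momentum Y) β (fieldK cov w β)) =ᶠ[𝓝 α] fun β =>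
      ∑ a, ∑ b, momentum (coordField e a) β * momentum (coordField e b) β *
        hamiltonianCov cov w e Y a b β.proj := by
    filter_upwards [eventually_projection hY,
      eventually_projection (e.open_source.mem_nhds hα)] with β h1 h2
    exact mvfderiv_momentum_fieldK_chart cov hw.isAlternatingField he h2 h1
  have hp := fun a => (he.coordField_smooth hα a).momentum.mdiff
  have hpp : ∀ a b, MDifferentiableAt (cotangentI n) 𝓘(ℝ, ℝ)
      (fun β => momentum (coordField e a) β * momentum (coordField e b) β) α := fun a b =>
    (hp a).mul (hp b)
  have hq := fun a b => (hamiltonianCov_smooth cov hw he hα hY a b).comp_projection.mdiff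
  rw [mvfderiv_congr h1, mvfderiv_sum _ (f := fun a β => ∑ b,
    momentum (coordField e a) β * momentum (coordField e b) β *
      hamiltonianCov cov w e Y a b β.proj)
    fun a _ => (mvfderiv_sum_apply _ fun b _ => (hpp a b).mul (hq a b)).1]
  refine Finset.sum_congr rfl fun a _ => ?_
  rw [mvfderiv_sum_mul _ (f := fun b β => momentum (coordField e a) β * momentum (coordField e b) β)
    (g := fun b (β : CotangentBundle n M) => hamiltonianCov cov w e Y a b β.proj)
    (fun b _ => hpp a b) (fun b _ => hq a b)]
  refine Finset.sum_congr rfl fun b _ => ?_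
  rw [mvfderiv_fun_mul (hp a) (hp b)]
  simp only [smul_add, smul_smul]
  rw [mul_comm (hamiltonianCov _ _ _ _ _ _ _), mul_comm (hamiltonianCov _ _ _ _ _ _ _)]
  abel

/-- In p_a p_b Q^{ab} the momenta commute with p_j, so p_j differentiates only the coefficients. -/
theorem canonicalBivector_fieldK_momentum_momentum (he : IsSmoothChart M e)
    (hα : α.proj ∈ e.source) {Y : ∀ x : M, TangentSpace (𝓡 n) x}
    (hY : ∀ᶠ y in 𝓝 α.proj, SmoothSectionAt n Y y) (j : Fin n) :
    canonicalBivector n M α (mvfderiv (cotangentI n) (fun β => mvfderiv (cotangentI n)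
        (momentum Y) β (fieldK cov w β)) α)
      (mvfderiv (cotangentI n) (momentum (coordField e j)) α) =
      -∑ a, ∑ b, momentum (coordField e a) α * momentum (coordField e b) α *
        mvfderiv (𝓡 n) (hamiltonianCov cov w e Y a b) α.proj (coordField e j α.proj) := by
  have hW := canonicalBivector_isAlternatingField (n := n) (M := M)
  rw [mvfderiv_fieldK_momentum cov hw he hα hY]
  simp only [hW.sum_left, ← Finset.sum_neg_distrib]
  refine Finset.sum_congr rfl fun a _ => Finset.sum_congr rfl fun b _ => ?_
  have h3 := fun a => bracket_momentum_coordField he hα a j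
  have h4 := bracket_momentum_projection (he.coordField_smooth hα j)
    (hamiltonianCov_smooth cov hw he hα hY a b).mdiff
  simp only [bracket] at h3 h4
  simp only [hW.add_left, hW.smul_left, h3]
  rw [hW.skew, h4]
  ring

/-- Here the coefficients commute with x^i, and {p_a, x^i} = δ_a^i removes one of the two momenta;
the two summands record which one. -/
theorem canonicalBivector_fieldK_momentum_projection (he : IsSmoothChart M e)
    (hα : α.proj ∈ e.source) {Y : ∀ x : M, TangentSpace (𝓡 n) x}
    (hY : ∀ᶠ y in 𝓝 α.proj, SmoothSectionAt n Y y) (i : Fin n) :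
    canonicalBivector n M α (mvfderiv (cotangentI n) (fun β => mvfderiv (cotangentI n)
        (momentum Y) β (fieldK cov w β)) α)
      (mvfderiv (cotangentI n) (fun β : CotangentBundle n M => coordFun e i β.proj) α) =
      ∑ a, momentum (coordField e a) α *
        (hamiltonianCov cov w e Y i a α.proj + hamiltonianCov cov w e Y a i α.proj) := by
  have hW := canonicalBivector_isAlternatingField (n := n) (M := M)
  have hx := (he.coordFun_contMDiffAt hα i).mdiff
  have h3 : ∀ a, canonicalBivector n M α (mvfderiv (cotangentI n) (momentum (coordField e a)) α)
      (mvfderiv (cotangentI n) (fun β : CotangentBundle n M => coordFun e i β.proj) α) =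
      if i = a then 1 else 0 := fun a => by
    rw [← he.mvfderiv_coordFun_coordField hα a i]
    exact bracket_momentum_projection (he.coordField_smooth hα a) hx
  have h4 : ∀ a b, canonicalBivector n M α
      (mvfderiv (cotangentI n) (fun β => hamiltonianCov cov w e Y a b β.proj) α)
      (mvfderiv (cotangentI n) (fun β : CotangentBundle n M => coordFun e i β.proj) α) = 0 :=
    fun a b => bracket_projection_projection
      (hamiltonianCov_smooth cov hw he hα hY a b).mdiff hx
  rw [mvfderiv_fieldK_momentum cov hw he hα hY]
  simp only [hW.sum_left, hW.add_left, hW.smul_left, h3, h4, mul_zero, Finset.sum_const_zero,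
    add_zero, mul_add, mul_ite, mul_one, Finset.sum_add_distrib]
  congr 1
  · rw [Finset.sum_comm]
    simp
  · simp

/-- The mixed components of the graded lift in a chart. -/
theorem bracket_gradedLift_coordFun_momentum (he : IsSmoothChart M e)
    (hα : α.proj ∈ e.source) (i j : Fin n) :
    bracket (cotangentI n) (gradedLift cov w) (fun β => coordFun e i β.proj)
      (momentum (coordField e j)) α =
      ∑ a, momentum (coordField e a) α * ((1 / 2 : ℝ) * (
        mvfderiv (𝓡 n) (bracket (𝓡 n) w (coordFun e a) (coordFun e i)) α.proj
          (coordField e j α.proj) +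
        (hamiltonianCov cov w e (coordField e j) i a α.proj +
          hamiltonianCov cov w e (coordField e j) a i α.proj))) := by
  have hsrc := e.open_source.mem_nhds hα
  -- {x^i, p_j} = -δ^i_j is constant near α, so the term K{x^i, p_j} drops out.
  have h0 : bracket (cotangentI n) (canonicalBivector n M) (fun β => coordFun e i β.proj)
      (momentum (coordField e j)) =ᶠ[𝓝 α] fun _ => -if i = j then 1 else 0 := by
    filter_upwards [eventually_projection hsrc] with β hβ
    rw [canonicalBivector_isAlternatingField.bracket_skew,
      bracket_momentum_projection (he.coordField_smooth hβ j) (he.coordFun_contMDiffAt hβ i).mdiff,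
      he.mvfderiv_coordFun_coordField hβ]
  have h1 : ∀ᶠ y in 𝓝 α.proj, ContMDiffAt (𝓡 n) 𝓘(ℝ, ℝ) ∞ (coordFun e i) y := by
    filter_upwards [hsrc] with y hy using he.coordFun_contMDiffAt hy i
  have h2 : ∀ᶠ y in 𝓝 α.proj, SmoothSectionAt n (coordField e j) y := by
    filter_upwards [hsrc] with y hy using he.coordField_smooth hy j
  rw [bracket_gradedLift cov hw h1.self_of_nhds.comp_projection h2.self_of_nhds.momentum, lieExpr,
    mvfderiv_congr h0, canonicalBivector_fieldK_projection_momentum cov hw he hα h1,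
    canonicalBivector_isAlternatingField.skew α
      (mvfderiv _ (fun β : CotangentBundle n M => coordFun e i β.proj) α),
    canonicalBivector_fieldK_momentum_projection cov hw he hα h2, mvfderiv_const]
  simp only [zero_apply, sub_neg_eq_add, zero_add, ← Finset.sum_add_distrib,
    Finset.mul_sum]
  exact Finset.sum_congr rfl fun a _ => by ring

/-- The vertical components of the graded lift in a chart. -/
theorem bracket_gradedLift_momentum_momentum (he : IsSmoothChart M e)
    (hα : α.proj ∈ e.source) (i j : Fin n) :
    bracket (cotangentI n) (gradedLift cov w) (momentum (coordField e i))
      (momentum (coordField e j)) α =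
      ∑ a, ∑ b, momentum (coordField e a) α * momentum (coordField e b) α * ((1 / 2 : ℝ) * (
        mvfderiv (𝓡 n) (hamiltonianCov cov w e (coordField e i) a b) α.proj
          (coordField e j α.proj) -
        mvfderiv (𝓡 n) (hamiltonianCov cov w e (coordField e j) a b) α.proj
          (coordField e i α.proj))) := by
  have hsrc := e.open_source.mem_nhds hα
  have h0 : bracket (cotangentI n) (canonicalBivector n M) (momentum (coordField e i))
      (momentum (coordField e j)) =ᶠ[𝓝 α] fun _ => 0 := by
    filter_upwards [eventually_projection hsrc] with β hβ
    exact bracket_momentum_coordField he hβ i j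
  have h2 : ∀ j, ∀ᶠ y in 𝓝 α.proj, SmoothSectionAt n (coordField e j) y := fun j => by
    filter_upwards [hsrc] with y hy using he.coordField_smooth hy j
  rw [bracket_gradedLift cov hw (h2 i).self_of_nhds.momentum (h2 j).self_of_nhds.momentum, lieExpr,
    mvfderiv_congr h0, canonicalBivector_fieldK_momentum_momentum cov hw he hα (h2 i),
    canonicalBivector_isAlternatingField.skew α (mvfderiv _ (momentum (coordField e i)) α),
    canonicalBivector_fieldK_momentum_momentum cov hw he hα (h2 j), mvfderiv_const]
  simp only [zero_apply, zero_sub, neg_neg, ← Finset.sum_sub_distrib, Finset.mul_sum]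
  exact Finset.sum_congr rfl fun a _ => Finset.sum_congr rfl fun b _ => by ring

theorem gradedLift_isGraded : IsGraded (gradedLift cov w) := by
  refine ⟨gradedLift_isBivectorField cov hw, fun e he => ?_⟩
  replace he : IsSmoothChart M e := he
  have hx : ∀ i, ∀ x ∈ e.source, ∀ᶠ y in 𝓝 x, ContMDiffAt (𝓡 n) 𝓘(ℝ, ℝ) ∞ (coordFun e i) y :=
    fun i x hx => by
      filter_upwards [e.open_source.mem_nhds hx] with y hy using he.coordFun_contMDiffAt hy i
  have hY : ∀ i, ∀ x ∈ e.source, ∀ᶠ y in 𝓝 x, SmoothSectionAt n (coordField e i) y :=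
    fun i x hx => by
      filter_upwards [e.open_source.mem_nhds hx] with y hy using he.coordField_smooth hy i
  have hc : ∀ i j, ∀ x ∈ e.source,
      ContMDiffAt (𝓡 n) 𝓘(ℝ, ℝ) ∞ (bracket (𝓡 n) w (coordFun e i) (coordFun e j)) x :=
    fun i j x h => he.bracket_coordFun_smooth hw h i (hx j x h)
  have hq : ∀ i a b, ∀ x ∈ e.source,
      ContMDiffAt (𝓡 n) 𝓘(ℝ, ℝ) ∞ (hamiltonianCov cov w e (coordField e i) a b) x :=
    fun i a b x h => hamiltonianCov_smooth cov hw he h (hY i x h) a b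
  have hd : ∀ i {f : M → ℝ}, ∀ x ∈ e.source, ContMDiffAt (𝓡 n) 𝓘(ℝ, ℝ) ∞ f x →
      ContMDiffAt (𝓡 n) 𝓘(ℝ, ℝ) ∞ (fun y => mvfderiv (𝓡 n) f y (coordField e i y)) x :=
    fun i f x h hf => (he.coordField_smooth h i).smoothFieldAt f hf
  -- The coefficients are those of the three bracket computations. They involve first derivatives of
  -- {x^a, x^i}_w and of Q, hence are smooth on the whole chart domain.
  refine ⟨fun i j => bracket (𝓡 n) w (coordFun e i) (coordFun e j),
    fun i a j x => (1 / 2 : ℝ) * (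
        mvfderiv (𝓡 n) (bracket (𝓡 n) w (coordFun e a) (coordFun e i)) x (coordField e j x) +
        (hamiltonianCov cov w e (coordField e j) i a x +
          hamiltonianCov cov w e (coordField e j) a i x)),
    fun a b i j x => (1 / 2 : ℝ) * (
        mvfderiv (𝓡 n) (hamiltonianCov cov w e (coordField e i) a b) x (coordField e j x) -
        mvfderiv (𝓡 n) (hamiltonianCov cov w e (coordField e j) a b) x (coordField e i x)),
    fun i j x h => (hc i j x h).contMDiffWithinAt,
    fun i a j x h => ContMDiffAt.contMDiffWithinAt ?_,
    fun a b i j x h => ContMDiffAt.contMDiffWithinAt ?_, fun α hα i j => ⟨?_, ?_, ?_⟩⟩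
  · exact contMDiffAt_const.mul ((hd j x h (hc a i x h)).add ((hq j i a x h).add (hq j a i x h)))
  · exact contMDiffAt_const.mul ((hd j x h (hq i a b x h)).sub (hd i x h (hq j a b x h)))
  · rw [coordX_eq, coordX_eq]
    exact bracket_gradedLift_projection cov hw (hx i α.proj hα) (hx j α.proj hα)
  · rw [coordX_eq, coordP_eq, bracket_gradedLift_coordFun_momentum cov hw he hα i j]
    simp only [coordP_eq]
  · rw [coordP_eq, coordP_eq, bracket_gradedLift_momentum_momentum cov hw he hα i j]
    simp only [coordP_eq]

end GradedLift

theorem proposition2p6 {n : ℕ} {M : Type*} [TopologicalSpace M] [T2Space M]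
    [ChartedSpace (EuclideanSpace ℝ (Fin n)) M] [IsManifold (𝓡 n) ∞ M]
    (w : BiField (𝓡 n) M) (hw : IsPoisson (𝓡 n) w)
    (cov : CovariantDerivative (𝓡 n) (EuclideanSpace ℝ (Fin n))
      (TangentSpace (𝓡 n) : M → Type _))
    [CovariantDerivative.ContMDiffCovariantDerivative cov ∞] :
    IsGraded (gradedLift cov w) ∧ IsSemiPoisson (gradedLift cov w) ∧
      IsProjRelated (gradedLift cov w) w :=
  ⟨gradedLift_isGraded cov hw.isBivectorField, gradedLift_isSemiPoisson cov hw.isBivectorField hw,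
    gradedLift_isProjRelated cov hw.isBivectorField⟩
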